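/- Let $k<n$ be positive integers. For $x\in[0,1]^n$ and nonempty $A\subseteq[n]=\{1,\dots,n\}$ let $C_0(x_A)=\max_{s\in[0,1]}\min_{j\in A}|s-x_j|$, and let $C_0(x_\emptyset)=1$. Exactly $k$ of the $n$ sensors fail, the set of failing sensors being uniformly distributed over the $k$-element subsets of $[n]$; thus the set $A$ of active sensors has probability $\Pr(E_A)=\binom nk^{-1}$ if $|A|=n-k$ and $\Pr(E_A)=0$ otherwise. Let $$C(x)=C^{k,n}(x)=\sum_{A\subseteq[n]}\Pr(E_A)\,C_0(x_A),$$ and call $x^*\in[0,1]^n$ optimal if it minimizes $C$ over $[0,1]^n$. Let $x^{\mathrm{eq}}=\frac1{2n}(1,3,\dots,2n-1)$, and let $x^{\mathrm{rand}}$ have i.i.d. entries, uniform in $[0,1]$. Write $A_1<\dots<A_{|A|}$ for the elements of $A$. Then: (a) (Linear program.) A vector $x^*\in\mathbb R^n$ with $x^*_1\le\dots\le x^*_n$ is optimal if and only if there is $w^*=(w^*_A)_{\emptyset\ne A\subseteq[n]}\in\mathbb R^{2^n-1}$ such that $(x^*,w^*)$ is an optimal solution of the linear program $$\min\sum_{A\neq\emptyset}\Pr(E_A)\,w_A\quad\text{subject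 to}\quad 0\le x_1\le\dots\le x_n\le1\ \text{ and, for every nonempty }A\subseteq[n],$$ $$w_A\ge\tfrac12(x_{A_{i+1}}-x_{A_i})\ (1\le i\le|A|-1),\qquad w_A\ge x_{A_1},\qquad w_A\ge 1-x_{A_{|A|}}.$$ (b) (Asymptotic cost of $x^{\mathrm{eq}}$.) For a fixed ratio $k/n=q\in(0,1)$ and $n\to\infty$, $$C(x^{\mathrm{eq}})\sim\frac1{2\log\frac nk}\,\frac{\log n}{n}.$$ More precisely, for every $\varepsilon$ with $0<\varepsilon<\min(q,1-q)$ there is a constant $K$, depending only on $q$ and $\varepsilon$, such that for all positive integers $k<n$ with $k/n=q$ $$\frac1{2\log\frac n{k-n\varepsilon}}\frac{\log n}n-\frac Kn\ \le\ C(x^{\mathrm{eq}})\ \le\ \frac1{2\log\frac n{k+n\varepsilon}}\frac{\log n}n+\frac Kn .$$ (c) (Near-optimality of $x^{\mathrm{eq}}$.) An optimal placement exists, and every optimal placement $x^*$ satisfies $$C(x^{\mathrm{eq}})\le C(x^*)+\frac2n\,\frac k{n-k}.$$ (d) (Asymptotic cost of $x^{\mathrm{rand}}$.) With $m=n-k$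 the number of active sensors, $$\mathbb E[C(x^{\mathrm{rand}})]=\frac{\log m}{2m}+O\!\left(\frac1m\right)\qquad(m\to\infty),$$ with an absolute implied constant. -/

import Mathlib

open Set MeasureTheory Filter Asymptotics Topology

noncomputable section

namespace SensorPlacement

/-- The coverage cost `C₀(x_A) = max_{s ∈ [0,1]} min_{j ∈ A} |s - x_j|` of the placement `x` when
`A` is the set of active sensors, with the convention `C₀(x_∅) = 1`. -/
def coverageCost {n : ℕ} (x : Fin n → ℝ) (A : Finset (Fin n)) : ℝ :=
  if h : A.Nonempty then ⨆ s : Icc (0 : ℝ) 1, A.inf' h (fun j => |(s : ℝ) - x j|) else 1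

/-- `C(x) = ∑_A Pr(E_A) C₀(x_A)`, where `P A = Pr(E_A)` is the probability that `A` is the set of
active sensors. -/
def expectedCost {n : ℕ} (P : Finset (Fin n) → ℝ) (x : Fin n → ℝ) : ℝ :=
  ∑ A : Finset (Fin n), P A * coverageCost x A

/-- Constant number of failures: the set of failing sensors (the complement of the set `A` of
active ones) is uniformly distributed over the `k`-element subsets of the `n` sensors. -/
def constFailProb (n k : ℕ) (A : Finset (Fin n)) : ℝ :=
  if Aᶜ.card = k then ((n.choose k : ℕ) : ℝ)⁻¹ else 0

/-- The expected cost `C(x)` in the model where exactly `k` of the `n` sensors fail. -/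
def constFailCost (n k : ℕ) (x : Fin n → ℝ) : ℝ :=
  expectedCost (constFailProb n k) x

/-- The placements, i.e. the points of the cube `[0,1]^n`. -/
def placements (n : ℕ) : Set (Fin n → ℝ) := {x | ∀ i, x i ∈ Icc (0 : ℝ) 1}

/-- `x` minimizes the expected cost over `[0,1]^n`. -/
def IsOptimalPlacement {n : ℕ} (P : Finset (Fin n) → ℝ) (x : Fin n → ℝ) : Prop :=
  x ∈ placements n ∧ ∀ y ∈ placements n, expectedCost P x ≤ expectedCost P y

/-- The `i`-th smallest element of `A`, counted from `0`. -/
def nthActive {n : ℕ} (A : Finset (Fin n)) (i : Fin A.card) : Fin n :=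
  A.orderEmbOfFin rfl i

/-- The constraints of the linear program, in the variables `x ∈ ℝ^n` and
`w = (w_A)_{A ≠ ∅} ∈ ℝ^(2^n-1)`. -/
structure LPFeasible {n : ℕ} (x : Fin n → ℝ) (w : {A : Finset (Fin n) // A.Nonempty} → ℝ) :
    Prop where
  nonneg : ∀ i, 0 ≤ x i
  sorted : ∀ i j, i ≤ j → x i ≤ x j
  le_one : ∀ i, x i ≤ 1
  gap : ∀ (A : {A : Finset (Fin n) // A.Nonempty}) (i : ℕ) (hi : i + 1 < A.1.card),
    1 / 2 * (x (nthActive A.1 ⟨i + 1, hi⟩) - x (nthActive A.1 ⟨i, Nat.lt_of_succ_lt hi⟩)) ≤ w A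
  left : ∀ A : {A : Finset (Fin n) // A.Nonempty}, x (A.1.min' A.2) ≤ w A
  right : ∀ A : {A : Finset (Fin n) // A.Nonempty}, 1 - x (A.1.max' A.2) ≤ w A

/-- The objective `∑_{A ≠ ∅} Pr(E_A) w_A` of the linear program. -/
def lpObjective {n : ℕ} (P : Finset (Fin n) → ℝ) (w : {A : Finset (Fin n) // A.Nonempty} → ℝ) :
    ℝ :=
  ∑ A : {A : Finset (Fin n) // A.Nonempty}, P A.1 * w A

/-- `(x, w)` is an optimal solution of the linear program. -/
def IsLPOptimal {n : ℕ} (P : Finset (Fin n) → ℝ) (x : Fin n → ℝ)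
    (w : {A : Finset (Fin n) // A.Nonempty} → ℝ) : Prop :=
  LPFeasible x w ∧ ∀ y v, LPFeasible y v → lpObjective P w ≤ lpObjective P v

/-- The equispaced placement `(1, 3, …, 2n-1) / (2n)`. -/
def equispaced (n : ℕ) (i : Fin n) : ℝ := (2 * (i : ℝ) + 1) / (2 * n)

/-- The law of the random placement: `n` independent positions, uniform in `[0,1]`. -/
def randomPlacement (n : ℕ) : Measure (Fin n → ℝ) :=
  Measure.pi fun _ => volume.restrict (Icc (0 : ℝ) 1)

end SensorPlacement

end

/-! (a) For a sorted placement, the point of `[0,1]` farthest from the active sensors is an endpoint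
or the midpoint of two consecutive active sensors. The coverage cost is therefore the least `w_A`
that the constraints allow. Since the failures are exchangeable, any placement can be sorted without
changing its expected cost.

(b), (c) Close `[0,1]` up to a circle and let `maxArc A` be the length of the longest cyclic arc
whose interior is inactive. Rotating the labels preserves the law of `A`, and the widths of the `n`
rotated copies of an arc of length `L` add up to `L` whatever the placement. Hence every placement
costs at least `E[maxArc] / (2n)` (`expected_arc_le_constFailCost`). The equispaced placement
attains this up to the runs of failures at the two ends, each of mean at most `k / (n - k)`
(`constFailCost_equispaced_le`); this is (c). It also reduces (b) to the longest run of failures. A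
union bound over arcs controls it from above. From below there is a second moment argument over
disjoint blocks, which works because failures are negatively correlated (`allFailProb_add_le`).

(d) Given `A`, the `m` active positions are independent and uniform, and the cost is governed by
half the largest spacing. The probability that the cost exceeds `j / (2m)` is small once `j` passes
`log m`, by a union bound over the windows of a grid (`measureReal_lt_coverageCost_le`). It is close
to `1` below `log m`, by a second moment bound on the number of gaps of length `j / m`
(`measureReal_le_coverageCost_ge`). Summing over `j` gives `(log m + O(1)) / (2m)`. -/

namespace SensorPlacement

/-! ### Coverage cost, the linear program, existence of an optimum -/

section

variable {n : ℕ} {x : Fin n → ℝ} {A : Finset (Fin n)}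

theorem bddAbove_coverage (x : Fin n → ℝ) (h : A.Nonempty) :
    BddAbove (range fun s : Icc (0 : ℝ) 1 => A.inf' h fun j => |(s : ℝ) - x j|) := by
  obtain ⟨j, hj⟩ := h
  refine ⟨1 + |x j|, ?_⟩
  rintro _ ⟨⟨s, hs0, hs1⟩, rfl⟩
  refine (Finset.inf'_le _ hj).trans ((abs_sub s (x j)).trans ?_)
  rw [abs_of_nonneg hs0]
  linarith

theorem le_coverageCost (hA : A.Nonempty) {s c : ℝ} (hs : s ∈ Icc (0 : ℝ) 1)
    (h : ∀ j ∈ A, c ≤ |s - x j|) : c ≤ coverageCost x A := by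
  rw [coverageCost, dif_pos hA]
  exact le_ciSup_of_le (bddAbove_coverage x hA) ⟨s, hs⟩ (Finset.le_inf' _ _ h)

theorem coverageCost_le (hA : A.Nonempty) {c : ℝ}
    (h : ∀ s ∈ Icc (0 : ℝ) 1, ∃ j ∈ A, |s - x j| ≤ c) : coverageCost x A ≤ c := by
  rw [coverageCost, dif_pos hA]
  have : Nonempty (Icc (0 : ℝ) 1) := ⟨⟨0, by simp⟩⟩
  refine ciSup_le fun s => ?_
  obtain ⟨j, hj, hc⟩ := h s s.2
  exact (Finset.inf'_le _ hj).trans hc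

theorem exists_of_lt_coverageCost (hA : A.Nonempty) {c : ℝ} (h : c < coverageCost x A) :
    ∃ s ∈ Icc (0 : ℝ) 1, ∀ j ∈ A, c < |s - x j| := by
  by_contra! hc
  exact absurd (coverageCost_le hA hc) (not_le.mpr h)

theorem exists_dist_le_coverageCost (hA : A.Nonempty) {s : ℝ} (hs : s ∈ Icc (0 : ℝ) 1) :
    ∃ j ∈ A, |s - x j| ≤ coverageCost x A := by
  rw [coverageCost, dif_pos hA]
  obtain ⟨j, hj, he⟩ := Finset.exists_mem_eq_inf' hA fun j => |s - x j|
  exact ⟨j, hj, he ▸ le_ciSup (bddAbove_coverage x hA) ⟨s, hs⟩⟩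

theorem coverageCost_nonneg (x : Fin n → ℝ) (A : Finset (Fin n)) : 0 ≤ coverageCost x A := by
  by_cases hA : A.Nonempty
  · exact le_coverageCost hA (s := 0) (by simp) fun j _ => abs_nonneg _
  · simp [coverageCost, hA]

theorem coverageCost_le_one (hx : x ∈ placements n) : coverageCost x A ≤ 1 := by
  by_cases hA : A.Nonempty
  · refine coverageCost_le hA fun s hs => ?_
    obtain ⟨j, hj⟩ := hA
    refine ⟨j, hj, abs_le.mpr ⟨?_, ?_⟩⟩ <;> linarith [(hx j).1, (hx j).2, hs.1, hs.2]
  · simp [coverageCost, hA]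

theorem coverageCost_comp_perm (x : Fin n → ℝ) (σ : Equiv.Perm (Fin n)) (A : Finset (Fin n)) :
    coverageCost (x ∘ σ) A = coverageCost x (A.map σ.toEmbedding) := by
  by_cases hA : A.Nonempty
  · have hA' : (A.map σ.toEmbedding).Nonempty := by simpa using hA
    simp only [coverageCost, dif_pos hA, dif_pos hA', Finset.inf'_map]
    rfl
  · simp [coverageCost, Finset.not_nonempty_iff_eq_empty.mp hA]

/-- Moving every sensor by at most `δ` changes each distance by at most `δ`. The resulting
continuity serves the compactness argument for optima and measurability in (d). -/
theorem lipschitzWith_coverageCost (A : Finset (Fin n)) :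
    LipschitzWith 1 fun x : Fin n → ℝ => coverageCost x A := by
  refine LipschitzWith.of_le_add fun x y => ?_
  by_cases hA : A.Nonempty
  · refine coverageCost_le hA fun s hs => ?_
    obtain ⟨j, hj, h⟩ := exists_dist_le_coverageCost (x := y) hA hs
    refine ⟨j, hj, ?_⟩
    have h1 := dist_le_pi_dist y x j
    rw [Real.dist_eq, dist_comm] at h1
    have := abs_sub_le s (y j) (x j)
    linarith
  · simp [coverageCost, hA]

theorem continuous_expectedCost (P : Finset (Fin n) → ℝ) : Continuous (expectedCost P) :=
  continuous_finsetSum _ fun A _ => continuous_const.mul (lipschitzWith_coverageCost A).continuous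

/-- For a monotone placement, the coverage cost is at most any bound on the two boundary gaps and
on half the gaps between consecutive active sensors. -/
theorem coverageCost_le_of_gaps (hx : Monotone x) (hA : A.Nonempty) {w : ℝ}
    (hl : x (A.min' hA) ≤ w) (hr : 1 - x (A.max' hA) ≤ w)
    (hg : ∀ p ∈ A, ∀ q ∈ A, p < q → (∀ l ∈ A, l ≤ p ∨ q ≤ l) → 1 / 2 * (x q - x p) ≤ w) :
    coverageCost x A ≤ w := by
  refine coverageCost_le hA fun s hs => ?_
  rcases le_or_gt s (x (A.min' hA)) with h1 | h1
  · refine ⟨_, A.min'_mem hA, ?_⟩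
    rw [abs_sub_comm, abs_of_nonneg (by linarith)]
    linarith [hs.1]
  rcases le_or_gt (x (A.max' hA)) s with h2 | h2
  · refine ⟨_, A.max'_mem hA, ?_⟩
    rw [abs_of_nonneg (by linarith)]
    linarith [hs.2]
  -- In the remaining case `s` lies between two consecutive active sensors `p` and `q`, and the
  -- nearer one is within half their distance.
  have hB : (A.filter fun j => x j ≤ s).Nonempty :=
    ⟨_, Finset.mem_filter.mpr ⟨A.min'_mem hA, h1.le⟩⟩
  have hC : (A.filter fun j => s < x j).Nonempty :=
    ⟨_, Finset.mem_filter.mpr ⟨A.max'_mem hA, h2⟩⟩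
  set p := (A.filter fun j => x j ≤ s).max' hB with hp
  set q := (A.filter fun j => s < x j).min' hC with hq
  have hpm := Finset.mem_filter.mp ((A.filter fun j => x j ≤ s).max'_mem hB)
  have hqm := Finset.mem_filter.mp ((A.filter fun j => s < x j).min'_mem hC)
  rw [← hp] at hpm
  rw [← hq] at hqm
  have hpq : p < q := by
    by_contra! h
    exact absurd (hx h) (by linarith [hpm.2, hqm.2])
  have hw := hg p hpm.1 q hqm.1 hpq fun l hl => by
    rcases le_or_gt (x l) s with h | h
    · exact Or.inl (Finset.le_max' _ _ (Finset.mem_filter.mpr ⟨hl, h⟩))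
    · exact Or.inr (Finset.min'_le _ _ (Finset.mem_filter.mpr ⟨hl, h⟩))
  rcases le_or_gt (s - x p) (x q - s) with h | h
  · refine ⟨p, hpm.1, ?_⟩
    rw [abs_of_nonneg (by linarith [hpm.2])]
    linarith
  · refine ⟨q, hqm.1, ?_⟩
    rw [abs_sub_comm, abs_of_nonneg (by linarith [hqm.2])]
    linarith

/-- A window free of active sensors bounds the coverage cost from below. -/
theorem half_gap_le_coverageCost (hA : A.Nonempty) {a b : ℝ} (ha : 0 ≤ a) (hb : b ≤ 1)
    (hab : a ≤ b) (h : ∀ j ∈ A, x j ≤ a ∨ b ≤ x j) : (b - a) / 2 ≤ coverageCost x A := by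
  refine le_coverageCost hA (s := (a + b) / 2) ⟨by linarith, by linarith⟩ fun j hj => ?_
  rcases h j hj with h | h
  · exact le_abs.mpr (Or.inl (by linarith))
  · exact le_abs.mpr (Or.inr (by linarith))

theorem le_coverageCost_left (hA : A.Nonempty) {a : ℝ} (h : ∀ j ∈ A, a ≤ x j) :
    a ≤ coverageCost x A :=
  le_coverageCost hA (s := 0) (by simp) fun j hj => le_abs.mpr (Or.inr (by linarith [h j hj]))

theorem le_coverageCost_right (hA : A.Nonempty) {a : ℝ} (h : ∀ j ∈ A, x j ≤ a) :
    1 - a ≤ coverageCost x A :=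
  le_coverageCost hA (s := 1) (by simp) fun j hj => le_abs.mpr (Or.inl (by linarith [h j hj]))

/-- Each constraint is witnessed by one point `s`: the midpoint of the gap, `0` or `1`. With
`LPFeasible.coverageCost_le`, the coverage costs are the smallest feasible `w`. -/
theorem lpFeasible_coverageCost (hx : Monotone x) (hx' : x ∈ placements n) :
    LPFeasible x fun A => coverageCost x A.1 where
  nonneg i := (hx' i).1
  sorted _ _ h := hx h
  le_one i := (hx' i).2
  gap A i hi := by
    have hlt : nthActive A.1 ⟨i, Nat.lt_of_succ_lt hi⟩ < nthActive A.1 ⟨i + 1, hi⟩ :=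
      (A.1.orderEmbOfFin rfl).lt_iff_lt.mpr (Fin.mk_lt_mk.mpr (Nat.lt_succ_self i))
    have := half_gap_le_coverageCost (x := x) A.2 (hx' _).1 (hx' _).2 (hx hlt.le) fun j hj => by
      have hr : j ∈ range (A.1.orderEmbOfFin rfl) := by
        rw [Finset.range_orderEmbOfFin]
        exact hj
      obtain ⟨l, rfl⟩ := hr
      rcases Nat.lt_or_ge i l.1 with h | h
      · exact Or.inr (hx ((A.1.orderEmbOfFin rfl).le_iff_le.mpr (Fin.mk_le_of_le_val h)))
      · exact Or.inl (hx ((A.1.orderEmbOfFin rfl).le_iff_le.mpr (Fin.mk_le_mk.mpr h)))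
    linarith
  left A := le_coverageCost_left A.2 fun j hj => hx (Finset.min'_le _ _ hj)
  right A := le_coverageCost_right A.2 fun j hj => hx (Finset.le_max' _ _ hj)

theorem LPFeasible.mem_placements {w} (h : LPFeasible x w) : x ∈ placements n :=
  fun i => ⟨h.nonneg i, h.le_one i⟩

theorem LPFeasible.coverageCost_le {w} (h : LPFeasible x w)
    (A : {A : Finset (Fin n) // A.Nonempty}) : coverageCost x A.1 ≤ w A := by
  refine coverageCost_le_of_gaps (fun i j hij => h.sorted i j hij) A.2 (h.left A) (h.right A)
    fun p hp q hq hpq hc => ?_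
  have hr : range (A.1.orderEmbOfFin rfl) = A.1 := Finset.range_orderEmbOfFin _ _
  obtain ⟨i, rfl⟩ : p ∈ range (A.1.orderEmbOfFin rfl) := by rw [hr]; exact hp
  obtain ⟨j, rfl⟩ : q ∈ range (A.1.orderEmbOfFin rfl) := by rw [hr]; exact hq
  have hij : i < j := (A.1.orderEmbOfFin rfl).lt_iff_lt.mp hpq
  have hi : i.1 + 1 < A.1.card := lt_of_le_of_lt (Nat.succ_le_of_lt hij) j.2
  -- No active sensor lies strictly between `p` and `q`, so their ranks in `A` are successive and a
  -- gap constraint applies.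
  have hj : j = ⟨i.1 + 1, hi⟩ := by
    rcases hc _ (A.1.orderEmbOfFin_mem rfl ⟨i.1 + 1, hi⟩) with h' | h'
    · have := Fin.le_def.mp ((A.1.orderEmbOfFin rfl).le_iff_le.mp h')
      simp at this
    · exact le_antisymm ((A.1.orderEmbOfFin rfl).le_iff_le.mp h')
        (Fin.mk_le_of_le_val (Nat.succ_le_of_lt hij))
  subst hj
  exact h.gap A i.1 hi

theorem constFailProb_nonneg (n k : ℕ) (A : Finset (Fin n)) : 0 ≤ constFailProb n k A := by
  unfold constFailProb
  split_ifs <;> positivity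

theorem constFailProb_empty {n k : ℕ} (h : k < n) : constFailProb n k ∅ = 0 := by
  simp [constFailProb, h.ne']

theorem constFailProb_map (n k : ℕ) (σ : Equiv.Perm (Fin n)) (A : Finset (Fin n)) :
    constFailProb n k (A.map σ.toEmbedding) = constFailProb n k A := by
  simp [constFailProb, Finset.card_compl]

theorem sum_constFailProb_map (n k : ℕ) (σ : Equiv.Perm (Fin n)) (f : Finset (Fin n) → ℝ) :
    ∑ A, constFailProb n k A * f (A.map σ.toEmbedding) = ∑ A, constFailProb n k A * f A := by
  rw [← Equiv.sum_comp σ.finsetCongr fun A => constFailProb n k A * f A]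
  refine Finset.sum_congr rfl fun A _ => ?_
  rw [Equiv.finsetCongr_apply, constFailProb_map]

theorem constFailCost_comp_perm (n k : ℕ) (x : Fin n → ℝ) (σ : Equiv.Perm (Fin n)) :
    constFailCost n k (x ∘ σ) = constFailCost n k x := by
  unfold constFailCost expectedCost
  simp only [coverageCost_comp_perm]
  exact sum_constFailProb_map n k σ fun A => coverageCost x A

theorem expectedCost_eq_lpObjective {P : Finset (Fin n) → ℝ} (hP : P ∅ = 0) (x : Fin n → ℝ) :
    expectedCost P x = lpObjective P fun A => coverageCost x A.1 := by
  unfold expectedCost lpObjective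
  rw [← Finset.sum_subtype (Finset.univ.filter Finset.Nonempty) (by simp)
    fun A => P A * coverageCost x A, Finset.sum_filter_of_ne]
  intro A _ h
  by_contra hA
  exact h (by rw [Finset.not_nonempty_iff_eq_empty.mp hA, hP, zero_mul])

theorem expectedCost_le_lpObjective {P : Finset (Fin n) → ℝ} (hP : P ∅ = 0) (hP0 : ∀ A, 0 ≤ P A)
    {w} (h : LPFeasible x w) : expectedCost P x ≤ lpObjective P w := by
  rw [expectedCost_eq_lpObjective hP]
  exact Finset.sum_le_sum fun A _ => mul_le_mul_of_nonneg_left (h.coverageCost_le A) (hP0 _)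

theorem isOptimalPlacement_iff_isLPOptimal {n k : ℕ} (hkn : k < n) {x : Fin n → ℝ}
    (hx : Monotone x) : IsOptimalPlacement (constFailProb n k) x ↔
      ∃ w, IsLPOptimal (constFailProb n k) x w := by
  have hP := constFailProb_empty hkn
  have hP0 := constFailProb_nonneg n k
  constructor
  · rintro ⟨hx', hopt⟩
    refine ⟨fun A => coverageCost x A.1, lpFeasible_coverageCost hx hx', fun y v hv => ?_⟩
    rw [← expectedCost_eq_lpObjective hP]
    exact (hopt y hv.mem_placements).trans (expectedCost_le_lpObjective hP hP0 hv)
  · rintro ⟨w, hw, hopt⟩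
    refine ⟨hw.mem_placements, fun y hy => ?_⟩
    -- The program only sees sorted placements, so the competitor `y` is replaced by its sorted
    -- version, which has the same expected cost.
    have h := hopt _ _ (lpFeasible_coverageCost (Tuple.monotone_sort y) fun i => hy _)
    rw [← expectedCost_eq_lpObjective hP] at h
    refine (expectedCost_le_lpObjective hP hP0 hw).trans (h.trans_eq ?_)
    exact constFailCost_comp_perm n k y _

theorem exists_isOptimalPlacement (P : Finset (Fin n) → ℝ) : ∃ x, IsOptimalPlacement P x := by
  have h : placements n = Set.pi univ fun _ => Icc (0 : ℝ) 1 := by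
    ext; simp only [placements, mem_ofPred_eq, mem_univ_pi]
  have hc : IsCompact (placements n) := h ▸ isCompact_univ_pi fun _ => isCompact_Icc
  obtain ⟨x, hx, hm⟩ := hc.exists_isMinOn ⟨fun _ => 0, fun _ => by simp⟩
    (continuous_expectedCost P).continuousOn
  exact ⟨x, hx, fun y hy => hm hy⟩

end

/-! ### The probability that given sensors all fail -/

section

/-- The probability that all sensors of a given set of `r` sensors fail. -/
noncomputable def allFailProb (n k r : ℕ) : ℝ := ((n - r).choose (n - k) : ℝ) / (n.choose k : ℝ)

theorem sum_constFailProb_disjoint {n k : ℕ} (hk : k ≤ n) (S : Finset (Fin n)) :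
    ∑ A, constFailProb n k A * (if Disjoint A S then 1 else 0) = allFailProb n k S.card := by
  have h : ∀ A : Finset (Fin n), constFailProb n k A * (if Disjoint A S then 1 else 0)
      = if A ∈ Sᶜ.powersetCard (n - k) then ((n.choose k : ℕ) : ℝ)⁻¹ else 0 := by
    intro A
    have hc : Aᶜ.card = k ↔ A.card = n - k := by
      have := A.card_le_univ
      rw [Fintype.card_fin] at this
      rw [Finset.card_compl, Fintype.card_fin]
      omega
    by_cases h1 : Disjoint A S <;> by_cases h2 : A.card = n - k <;>
      simp [constFailProb, hc, h1, h2, Finset.mem_powersetCard, Finset.subset_compl_iff_disjoint_right]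
  rw [Finset.sum_congr rfl fun A _ => h A, Finset.sum_ite_mem, Finset.univ_inter,
    Finset.sum_const, Finset.card_powersetCard, Finset.card_compl, Fintype.card_fin, nsmul_eq_mul,
    allFailProb, div_eq_mul_inv]

theorem allFailProb_zero {n k : ℕ} (hk : k ≤ n) : allFailProb n k 0 = 1 := by
  have : (n.choose k : ℝ) ≠ 0 := by exact_mod_cast (Nat.choose_pos hk).ne'
  rw [allFailProb, Nat.sub_zero, Nat.choose_symm hk, div_self this]

theorem sum_constFailProb {n k : ℕ} (hk : k ≤ n) : ∑ A, constFailProb n k A = 1 := by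
  simpa [allFailProb_zero hk] using sum_constFailProb_disjoint hk ∅

theorem allFailProb_nonneg (n k r : ℕ) : 0 ≤ allFailProb n k r := by
  unfold allFailProb; positivity

theorem allFailProb_of_lt {n k r : ℕ} (hk : k < n) (hr : k < r) : allFailProb n k r = 0 := by
  rw [allFailProb, Nat.choose_eq_zero_of_lt (by omega), Nat.cast_zero, zero_div]

/-- Once `r` given sensors have failed, `k - r` of the other `n - r` fail, so the next one fails
with conditional probability `(k - r) / (n - r)`. -/
theorem allFailProb_succ {n k r : ℕ} (hk : k < n) (hr : r ≤ k) :
    allFailProb n k (r + 1) = allFailProb n k r * (((k : ℝ) - r) / (n - r)) := by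
  have h := Nat.choose_mul_succ_eq (n - (r + 1)) (n - k)
  have h1 : n - (r + 1) + 1 = n - r := by omega
  have h2 : n - r - (n - k) = k - r := by omega
  rw [h1, h2] at h
  have h3 : ((n - (r + 1)).choose (n - k) : ℝ) * ((n : ℝ) - r)
      = ((n - r).choose (n - k) : ℝ) * ((k : ℝ) - r) := by
    rw [← Nat.cast_sub hr, ← Nat.cast_sub (hr.trans hk.le)]
    exact_mod_cast h
  have h4 : (0 : ℝ) < (n : ℝ) - r := sub_pos.mpr (by exact_mod_cast hr.trans_lt hk)
  unfold allFailProb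
  rw [div_mul_div_comm, mul_comm (n.choose k : ℝ), ← h3, mul_comm _ ((n : ℝ) - r),
    mul_div_mul_left _ _ h4.ne']

/-- Negative correlation: `r` extra failures lower each conditional factor from `(k - s) / (n - s)`
to `(k - r - s) / (n - r - s)`. This is what bounds the second moment of the number of failing
blocks. -/
theorem allFailProb_add_le {n k : ℕ} (hk : k < n) (r s : ℕ) :
    allFailProb n k (r + s) ≤ allFailProb n k r * allFailProb n k s := by
  induction s with
  | zero => rw [allFailProb_zero hk.le, mul_one, add_zero]
  | succ s ih =>
    rcases Nat.lt_or_ge k (r + (s + 1)) with h | h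
    · rw [allFailProb_of_lt hk h]
      exact mul_nonneg (allFailProb_nonneg _ _ _) (allFailProb_nonneg _ _ _)
    · rw [← add_assoc, allFailProb_succ hk (by omega), allFailProb_succ hk (by omega), ← mul_assoc]
      have hkn : (k : ℝ) ≤ n := by exact_mod_cast hk.le
      have h1 : ((r + s + 1 : ℕ) : ℝ) ≤ k := by exact_mod_cast h
      have h2 : (k : ℝ) < n := by exact_mod_cast hk
      push_cast at h1 ⊢
      have h3 : ((k : ℝ) - (r + s)) / (n - (r + s)) ≤ (k - s) / (n - s) := by
        rw [div_le_div_iff₀ (by linarith) (by linarith [(Nat.cast_nonneg r : (0 : ℝ) ≤ r)])]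
        nlinarith [(Nat.cast_nonneg r : (0 : ℝ) ≤ r)]
      refine mul_le_mul ih h3 (div_nonneg (by linarith) (by linarith)) ?_
      exact mul_nonneg (allFailProb_nonneg _ _ _) (allFailProb_nonneg _ _ _)

theorem allFailProb_le_pow {n k : ℕ} (hk : k < n) (r : ℕ) :
    allFailProb n k r ≤ ((k : ℝ) / n) ^ r := by
  induction r with
  | zero => rw [allFailProb_zero hk.le, pow_zero]
  | succ r ih =>
    have h1 : allFailProb n k 1 = (k : ℝ) / n := by
      simpa [allFailProb_zero hk.le] using allFailProb_succ hk (Nat.zero_le k)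
    rw [pow_succ]
    refine (allFailProb_add_le hk r 1).trans ?_
    rw [h1]
    exact mul_le_mul_of_nonneg_right ih (by positivity)

/-- Every factor `(k - r) / (n - r)` with `r < T` is at least `(k - T) / n`. -/
theorem pow_le_allFailProb {n k : ℕ} (hk : k < n) {T : ℕ} {β : ℝ} (hβ : 0 ≤ β)
    (hT : β ≤ ((k : ℝ) - T) / n) {r : ℕ} (hr : r ≤ T) : β ^ r ≤ allFailProb n k r := by
  induction r with
  | zero => rw [allFailProb_zero hk.le, pow_zero]
  | succ r ih =>
    have hn : (0 : ℝ) < n := by exact_mod_cast (Nat.zero_le k).trans_lt hk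
    have hkT : (T : ℝ) ≤ k := by
      have := (le_div_iff₀ hn).mp hT
      nlinarith
    have hkT' : T ≤ k := by exact_mod_cast hkT
    have hr' : ((r + 1 : ℕ) : ℝ) ≤ T := by exact_mod_cast hr
    have hkn : (k : ℝ) < n := by exact_mod_cast hk
    push_cast at hr'
    rw [pow_succ, allFailProb_succ hk (by omega)]
    refine mul_le_mul (ih (by omega)) (hT.trans ?_) hβ (allFailProb_nonneg _ _ _)
    exact div_le_div₀ (by linarith) (by linarith) (by linarith)
      (by linarith [(Nat.cast_nonneg r : (0 : ℝ) ≤ r)])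

end

/-! ### Cyclic arcs, averaging over rotations, near-optimality -/

section

/-- No sensor strictly between positions `i` and `i + L` of the cyclic order is active. -/
def EmptyArc {n : ℕ} [NeZero n] (A : Finset (Fin n)) (i L : ℕ) : Prop :=
  ∀ l, i < l → l < i + L → Fin.ofNat n l ∉ A

/-- The periodic extension of a placement to a circle of circumference `1`. -/
noncomputable def unroll {n : ℕ} [NeZero n] (x : Fin n → ℝ) (l : ℕ) : ℝ :=
  x (Fin.ofNat n l) + (l / n : ℕ)

/-- The rotation by `t` places of the cyclic order. -/
def rotation (n : ℕ) [NeZero n] (t : ℕ) : Equiv.Perm (Fin n) := Equiv.addRight (Fin.ofNat n t)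

variable {n : ℕ} [NeZero n] {x : Fin n → ℝ} {A : Finset (Fin n)}

theorem unroll_add_self (x : Fin n → ℝ) (l : ℕ) : unroll x (l + n) = unroll x l + 1 := by
  have h : Fin.ofNat n (l + n) = Fin.ofNat n l := by
    ext; simp
  rw [unroll, unroll, h, Nat.add_div_right _ (NeZero.pos n)]
  push_cast
  ring

theorem rotation_ofNat (t l : ℕ) : rotation n t (Fin.ofNat n l) = Fin.ofNat n (l + t) := by
  ext
  simp [rotation, Fin.val_add]

theorem EmptyArc.rotate {i L : ℕ} (h : EmptyArc A i L) (t : ℕ) :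
    EmptyArc (A.map (rotation n t).toEmbedding) (i + t) L := by
  intro l h1 h2 hl
  obtain ⟨d, rfl⟩ : ∃ d, l = d + t := ⟨l - t, by omega⟩
  rw [← rotation_ofNat, ← Equiv.coe_toEmbedding, Finset.mem_map'] at hl
  exact h d (by omega) (by omega) hl

/-- An arc that does not wrap is an ordinary gap, costing half its width. An arc that wraps consists
of the two boundary gaps; the cost is at least each of them, hence at least half their sum. -/
theorem EmptyArc.unroll_le (hx : Monotone x) (hx' : x ∈ placements n) (hA : A.Nonempty) {i L : ℕ}
    (hL : L ≤ n) (h : EmptyArc A i L) :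
    (unroll x (i + L) - unroll x i) / 2 ≤ coverageCost x A := by
  obtain ⟨q, a, ha, rfl⟩ : ∃ q a, a < n ∧ i = n * q + a :=
    ⟨i / n, i % n, Nat.mod_lt _ (NeZero.pos n), (Nat.div_add_mod i n).symm⟩
  have hn := NeZero.pos n
  have key : ∀ j ∈ A, ∀ l, n * q + a < l → l < n * q + a + L → l % n ≠ j.1 := by
    intro j hj l h1 h2 h3
    refine h l h1 h2 ?_
    have : Fin.ofNat n l = j := Fin.ext h3
    rwa [this]
  have hmod : ∀ c, c < n → ∀ p, unroll x (n * p + c) = x (Fin.ofNat n c) + p := by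
    intro c hc p
    have h1 : Fin.ofNat n (n * p + c) = Fin.ofNat n c := by ext; simp
    rw [unroll, h1, Nat.mul_add_div hn, Nat.div_eq_of_lt hc, add_zero]
  have hle : ∀ c, c < n → ∀ j : Fin n, c ≤ j.1 → x (Fin.ofNat n c) ≤ x j := fun c hc j hj =>
    hx (Fin.le_def.mpr (by simpa [Nat.mod_eq_of_lt hc] using hj))
  have hge : ∀ c, c < n → ∀ j : Fin n, j.1 ≤ c → x j ≤ x (Fin.ofNat n c) := fun c hc j hj =>
    hx (Fin.le_def.mpr (by simpa [Nat.mod_eq_of_lt hc] using hj))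
  have h1 : ∀ j ∈ A, j.1 ≤ a ∨ a + L ≤ j.1 := by
    intro j hj
    by_contra! hc
    exact key j hj (n * q + j.1) (by omega) (by omega)
      (by rw [Nat.mul_add_mod, Nat.mod_eq_of_lt j.2])
  rcases Nat.lt_or_ge (a + L) n with hw | hw
  · rw [add_assoc, hmod _ hw, hmod _ ha]
    have := half_gap_le_coverageCost (x := x) hA (hx' (Fin.ofNat n a)).1
      (hx' (Fin.ofNat n (a + L))).2 (hle a ha _ (by simp [Nat.mod_eq_of_lt hw]))
      fun j hj => (h1 j hj).imp (hge a ha j) (hle _ hw j)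
    linarith
  · obtain ⟨b, hb⟩ : ∃ b, a + L = n + b := ⟨a + L - n, by omega⟩
    have hbn : b < n := by omega
    have h2 : ∀ j ∈ A, b ≤ j.1 := by
      intro j hj
      by_contra! hc
      refine key j hj (n * (q + 1) + j.1) ?_ ?_ (by rw [Nat.mul_add_mod, Nat.mod_eq_of_lt j.2])
      · rw [mul_add]; omega
      · rw [mul_add]; omega
    have h3 := le_coverageCost_left (x := x) hA fun j hj => hle b hbn j (h2 j hj)
    have h4 := le_coverageCost_right (x := x) hA fun j hj =>
      hge a ha j ((h1 j hj).resolve_right (by have := j.2; omega))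
    have h5 : n * q + a + L = n * (q + 1) + b := by rw [mul_add]; omega
    rw [h5, hmod _ hbn, hmod _ ha]
    push_cast
    linarith

/-- Raising `L` by one adds a sum of successive increments that telescopes around the whole circle,
which has circumference `1`. -/
theorem sum_unroll_sub (x : Fin n → ℝ) (i L : ℕ) :
    ∑ t ∈ Finset.range n, (unroll x (i + t + L) - unroll x (i + t)) = L := by
  induction L with
  | zero => simp
  | succ L ih =>
    have h : ∑ t ∈ Finset.range n, (unroll x (i + t + (L + 1)) - unroll x (i + t + L)) = 1 := by
      have := Finset.sum_range_sub (fun t => unroll x (i + L + t)) n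
      rw [unroll_add_self, add_zero, add_sub_cancel_left] at this
      rw [← this]
      refine Finset.sum_congr rfl fun t _ => ?_
      congr 2 <;> ring
    push_cast
    rw [← ih, ← h, ← Finset.sum_add_distrib]
    refine Finset.sum_congr rfl fun t _ => ?_
    ring

theorem EmptyArc.half_le_sum_rotation (hx : Monotone x) (hx' : x ∈ placements n)
    (hA : A.Nonempty) {i L : ℕ} (hL : L ≤ n) (h : EmptyArc A i L) :
    (L : ℝ) / 2 ≤ ∑ t ∈ Finset.range n, coverageCost x (A.map (rotation n t).toEmbedding) := by
  rw [← sum_unroll_sub x i L, Finset.sum_div]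
  exact Finset.sum_le_sum fun t _ => (h.rotate t).unroll_le hx hx' (hA.map) hL

/-- Averaging over rotations: the expected cost of any placement is at least the expected length of
an inactive arc, in units of the equispaced placement. -/
theorem expected_arc_le_constFailCost {k : ℕ} (hk : k < n) (hx : x ∈ placements n)
    (L : Finset (Fin n) → ℕ) (hL : ∀ A, A.Nonempty → L A ≤ n ∧ ∃ i, EmptyArc A i (L A)) :
    (∑ A, constFailProb n k A * L A) / (2 * n) ≤ constFailCost n k x := by
  rw [← constFailCost_comp_perm n k x (Tuple.sort x)]
  have hy := Tuple.monotone_sort x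
  have hy' : x ∘ Tuple.sort x ∈ placements n := fun i => hx _
  set y := x ∘ Tuple.sort x
  have hn : (0 : ℝ) < n := by exact_mod_cast NeZero.pos n
  have h1 : ∑ t ∈ Finset.range n, constFailCost n k y = n * constFailCost n k y := by simp
  have h2 : ∑ t ∈ Finset.range n, constFailCost n k y = ∑ A, constFailProb n k A *
      ∑ t ∈ Finset.range n, coverageCost y (A.map (rotation n t).toEmbedding) := by
    simp only [Finset.mul_sum]
    rw [Finset.sum_comm]
    exact Finset.sum_congr rfl fun t _ =>
      (sum_constFailProb_map n k (rotation n t) fun A => coverageCost y A).symm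
  have h3 : ∑ A, constFailProb n k A * ((L A : ℝ) / 2) ≤ n * constFailCost n k y := by
    rw [← h1, h2]
    refine Finset.sum_le_sum fun A _ => ?_
    rcases A.eq_empty_or_nonempty with rfl | hA
    · simp [constFailProb_empty hk]
    · obtain ⟨hLn, i, hi⟩ := hL A hA
      exact mul_le_mul_of_nonneg_left (hi.half_le_sum_rotation hy hy' hA hLn)
        (constFailProb_nonneg _ _ _)
  rw [div_le_iff₀ (by positivity)]
  simp only [mul_div_assoc', ← Finset.sum_div] at h3
  linarith

/-- The first `j` sensors. -/
def firstSensors (n j : ℕ) : Finset (Fin n) := {i : Fin n | i.1 < j}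

/-- The last `j` sensors. -/
def lastSensors (n j : ℕ) : Finset (Fin n) := {i : Fin n | n - j ≤ i.1}

open Classical in
/-- The length of the longest arc of the cyclic order whose interior has no active sensor. -/
noncomputable def maxArc (A : Finset (Fin n)) : ℕ :=
  Nat.findGreatest (fun L => ∃ i : ℕ, EmptyArc A i L) n

theorem maxArc_le (A : Finset (Fin n)) : maxArc A ≤ n := by
  classical
  exact Nat.findGreatest_le n

theorem exists_emptyArc_maxArc (A : Finset (Fin n)) : ∃ i, EmptyArc A i (maxArc A) := by
  classical
  unfold maxArc
  exact Nat.findGreatest_spec (P := fun L => ∃ i : ℕ, EmptyArc A i L) (Nat.zero_le n)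
    ⟨0, fun l _ _ => by omega⟩

theorem EmptyArc.le_maxArc {i L : ℕ} (hL : L ≤ n) (h : EmptyArc A i L) : L ≤ maxArc A := by
  classical
  exact Nat.le_findGreatest hL ⟨i, h⟩

theorem natCast_le_sum_ite {a N : ℕ} {p : ℕ → Prop} [DecidablePred p] (ha : a ≤ N)
    (h : ∀ j, 1 ≤ j → j ≤ a → p j) :
    (a : ℝ) ≤ ∑ j ∈ Finset.Icc 1 N, if p j then (1 : ℝ) else 0 := by
  have h1 : ∑ j ∈ Finset.Icc 1 a, (if p j then (1 : ℝ) else 0) = a := by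
    rw [Finset.sum_congr rfl fun j hj => if_pos (h j (Finset.mem_Icc.mp hj).1
      (Finset.mem_Icc.mp hj).2)]
    simp
  rw [← h1]
  refine Finset.sum_le_sum_of_subset_of_nonneg (Finset.Icc_subset_Icc_right ha) fun j _ _ => ?_
  split_ifs <;> norm_num

/-- The two sums dominate the numbers `a` and `b` of failures before the first and after the last
active sensor. An inner gap costs at most `maxArc A` in units of `1 / (2n)`. The boundary gaps cost
`2a + 1` and `2b + 1`, whereas the arc through the boundary only gives `a + b + 1`; the sums make up
the difference. -/
theorem coverageCost_equispaced_le (hA : A.Nonempty) :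
    coverageCost (equispaced n) A ≤ 1 / (2 * n) * (maxArc A
      + (∑ j ∈ Finset.Icc 1 n, if Disjoint A (firstSensors n j) then 1 else 0)
      + ∑ j ∈ Finset.Icc 1 n, if Disjoint A (lastSensors n j) then 1 else 0) := by
  have hn : (0 : ℝ) < n := by exact_mod_cast NeZero.pos n
  set a := (A.min' hA).1 with ha
  set b := n - 1 - (A.max' hA).1 with hb
  have hmin : ∀ l ∈ A, a ≤ l.1 := fun l hl => Fin.le_def.mp (A.min'_le l hl)
  have hmax : ∀ l ∈ A, l.1 ≤ (A.max' hA).1 := fun l hl => Fin.le_def.mp (A.le_max' l hl)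
  have h1 : (a : ℝ) ≤ ∑ j ∈ Finset.Icc 1 n, if Disjoint A (firstSensors n j) then 1 else 0 :=
    natCast_le_sum_ite (A.min' hA).2.le fun j _ hj => by
      rw [Finset.disjoint_left]
      intro l hl hlj
      have := hmin l hl
      have := (Finset.mem_filter.mp hlj).2
      omega
  have h2 : (b : ℝ) ≤ ∑ j ∈ Finset.Icc 1 n, if Disjoint A (lastSensors n j) then 1 else 0 :=
    natCast_le_sum_ite (by omega) fun j _ hj => by
      rw [Finset.disjoint_left]
      intro l hl hlj
      have := hmax l hl
      have := (Finset.mem_filter.mp hlj).2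
      have := (A.max' hA).2
      omega
  have h3 : a + b + 1 ≤ maxArc A := by
    have h5 := hmin _ (A.max'_mem hA)
    have h6 := (A.max' hA).2
    refine EmptyArc.le_maxArc (i := (A.max' hA).1) (by omega) fun l hl1 hl2 hl => ?_
    have h3 := hmin _ hl
    have h4 := hmax _ hl
    simp only [Fin.val_ofNat] at h3 h4
    rcases Nat.lt_or_ge l n with h | h
    · rw [Nat.mod_eq_of_lt h] at h4
      omega
    · rw [Nat.mod_eq_sub_mod h, Nat.mod_eq_of_lt (by omega)] at h3
      omega
  have h3' : (a : ℝ) + b + 1 ≤ maxArc A := by exact_mod_cast h3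
  have ha0 : (0 : ℝ) ≤ a := Nat.cast_nonneg a
  have hb0 : (0 : ℝ) ≤ b := Nat.cast_nonneg b
  have hmono : Monotone (equispaced n) := fun i j hij => by
    have : (i : ℝ) ≤ j := by exact_mod_cast Fin.le_def.mp hij
    unfold equispaced
    gcongr
  refine le_trans ?_ (mul_le_mul_of_nonneg_left (add_le_add (add_le_add_right h1 _) h2)
    (by positivity))
  refine coverageCost_le_of_gaps hmono hA ?_ ?_ fun p hp q hq hpq hc => ?_
  · rw [equispaced, ← ha, div_eq_inv_mul, ← one_div]
    exact mul_le_mul_of_nonneg_left (by linarith) (by positivity)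
  · have : ((A.max' hA).1 : ℝ) = n - 1 - b := by
      have h6 := (A.max' hA).2
      rw [eq_sub_iff_add_eq, eq_sub_iff_add_eq]
      exact_mod_cast (by omega : (A.max' hA).1 + b + 1 = n)
    have h7 : 1 - equispaced n (A.max' hA) = 1 / (2 * n) * (2 * b + 1) := by
      rw [equispaced, this]
      field_simp
      ring
    rw [h7]
    exact mul_le_mul_of_nonneg_left (by linarith) (by positivity)
  · have hpq' := Fin.lt_def.mp hpq
    have h8 : q.1 - p.1 ≤ maxArc A := by
      have := q.2
      refine EmptyArc.le_maxArc (i := p.1) (by omega) fun l hl1 hl2 hl => ?_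
      have h9 := hc _ hl
      rw [Fin.le_def, Fin.le_def, Fin.val_ofNat, Nat.mod_eq_of_lt (by omega)] at h9
      omega
    have h8' : (q.1 : ℝ) - p.1 ≤ maxArc A := by
      rw [sub_le_iff_le_add]
      exact_mod_cast (by omega : q.1 ≤ maxArc A + p.1)
    have h9 : 1 / 2 * (equispaced n q - equispaced n p) = 1 / (2 * n) * ((q.1 : ℝ) - p.1) := by
      unfold equispaced
      field_simp
      ring
    rw [h9]
    exact mul_le_mul_of_nonneg_left (by linarith) (by positivity)

theorem sum_geometric_Icc_le {r : ℝ} (hr0 : 0 ≤ r) (hr : r < 1) (N : ℕ) :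
    ∑ j ∈ Finset.Icc 1 N, r ^ j ≤ r / (1 - r) := by
  have h1 : (0 : ℝ) < 1 - r := by linarith
  have h : ∑ j ∈ Finset.Icc 1 N, r ^ j = (r - r ^ (N + 1)) / (1 - r) := by
    induction N with
    | zero => simp
    | succ N ih =>
      rw [Finset.sum_Icc_succ_top (by omega), ih]
      field_simp
      ring
  rw [h]
  gcongr
  linarith [pow_nonneg hr0 (N + 1)]

/-- The mean length of a boundary run is the sum over `j ≥ 1` of the probability that `j` given
sensors fail, at most the geometric series `∑ (k / n) ^ j = k / (n - k)`. -/
theorem constFailCost_equispaced_le {k : ℕ} (hk : k < n) :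
    constFailCost n k (equispaced n) ≤
      1 / (2 * n) * (∑ A, constFailProb n k A * maxArc A + 2 * (k / ((n : ℝ) - k))) := by
  have hn : (0 : ℝ) < n := by exact_mod_cast NeZero.pos n
  have hkn : (k : ℝ) < n := by exact_mod_cast hk
  have h0 : ∑ j ∈ Finset.Icc 1 n, allFailProb n k j ≤ k / ((n : ℝ) - k) := by
    refine (Finset.sum_le_sum fun j _ => allFailProb_le_pow hk j).trans ?_
    refine (sum_geometric_Icc_le (by positivity) ((div_lt_one hn).mpr hkn) n).trans_eq ?_
    have : (n : ℝ) - k ≠ 0 := by linarith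
    field_simp
  have hS : ∀ S : ℕ → Finset (Fin n), (∀ j ≤ n, (S j).card = j) →
      ∑ A, constFailProb n k A * (∑ j ∈ Finset.Icc 1 n, if Disjoint A (S j) then (1 : ℝ) else 0)
        ≤ k / ((n : ℝ) - k) := by
    intro S hS
    refine le_trans (le_of_eq ?_) h0
    simp only [Finset.mul_sum]
    rw [Finset.sum_comm]
    refine Finset.sum_congr rfl fun j hj => ?_
    rw [sum_constFailProb_disjoint hk.le, hS j (Finset.mem_Icc.mp hj).2]
  have h1 := hS (firstSensors n) fun j hj => by
    simp [firstSensors, Fin.card_filter_val_lt, hj]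
  have h2 := hS (lastSensors n) fun j hj => by
    have := Finset.card_filter_add_card_filter_not (s := (Finset.univ : Finset (Fin n)))
      (fun i : Fin n => i.1 < n - j)
    simp [lastSensors, Fin.card_filter_val_lt] at this ⊢
    omega
  calc constFailCost n k (equispaced n)
      ≤ ∑ A, constFailProb n k A * (1 / (2 * n) * (maxArc A
        + (∑ j ∈ Finset.Icc 1 n, if Disjoint A (firstSensors n j) then 1 else 0)
        + ∑ j ∈ Finset.Icc 1 n, if Disjoint A (lastSensors n j) then 1 else 0)) := by
        unfold constFailCost expectedCost
        refine Finset.sum_le_sum fun A _ => ?_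
        rcases A.eq_empty_or_nonempty with rfl | hA
        · simp [constFailProb_empty hk]
        · exact mul_le_mul_of_nonneg_left (coverageCost_equispaced_le hA)
            (constFailProb_nonneg _ _ _)
    _ = 1 / (2 * n) * (∑ A, constFailProb n k A * maxArc A
        + ∑ A, constFailProb n k A * (∑ j ∈ Finset.Icc 1 n,
            if Disjoint A (firstSensors n j) then 1 else 0)
        + ∑ A, constFailProb n k A * (∑ j ∈ Finset.Icc 1 n,
            if Disjoint A (lastSensors n j) then 1 else 0)) := by
        rw [← Finset.sum_add_distrib, ← Finset.sum_add_distrib, Finset.mul_sum]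
        refine Finset.sum_congr rfl fun A _ => by ring
    _ ≤ _ := mul_le_mul_of_nonneg_left (by linarith) (by positivity)

theorem equispaced_near_optimal {k : ℕ} (hk : k < n) (hx : x ∈ placements n) :
    constFailCost n k (equispaced n) ≤
      constFailCost n k x + 2 / (n : ℝ) * ((k : ℝ) / ((n : ℝ) - k)) := by
  have hn : (0 : ℝ) < n := by exact_mod_cast NeZero.pos n
  have hkn : (k : ℝ) < n := by exact_mod_cast hk
  have h1 := constFailCost_equispaced_le hk
  have h2 := expected_arc_le_constFailCost hk hx maxArc fun A _ =>
    ⟨maxArc_le A, exists_emptyArc_maxArc A⟩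
  have h3 : 0 ≤ 1 / (n : ℝ) * ((k : ℝ) / ((n : ℝ) - k)) :=
    mul_nonneg (by positivity) (div_nonneg (by positivity) (by linarith))
  have h4 : 1 / (2 * (n : ℝ)) * (∑ A, constFailProb n k A * maxArc A + 2 * (k / ((n : ℝ) - k)))
      = (∑ A, constFailProb n k A * maxArc A) / (2 * n) + 1 / n * (k / ((n : ℝ) - k)) := by
    field_simp
  have h5 : 2 / (n : ℝ) * ((k : ℝ) / ((n : ℝ) - k)) = 2 * (1 / n * (k / ((n : ℝ) - k))) := by ring
  linarith

end

/-! ### Longest run of failures and asymptotics of the equispaced cost -/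

/-- The `b`-th block of `T` consecutive sensors. -/
def block (n T b : ℕ) : Finset (Fin n) := {i : Fin n | b * T ≤ i.1 ∧ i.1 < b * T + T}

theorem card_block {n T b : ℕ} (h : b * T + T ≤ n) : (block n T b).card = T := by
  have h1 : (block n T b).map Fin.valEmbedding = Finset.Ico (b * T) (b * T + T) := by
    ext l
    simp only [block, Finset.mem_map, Finset.mem_filter, Finset.mem_univ, true_and,
      Fin.valEmbedding_apply, Finset.mem_Ico]
    exact ⟨fun ⟨a, ha, hl⟩ => hl ▸ ha, fun hl => ⟨⟨l, by omega⟩, hl, rfl⟩⟩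
  rw [← Finset.card_map, h1, Nat.card_Ico, Nat.add_sub_cancel_left]

theorem disjoint_block {n T b c : ℕ} (h : b ≠ c) : Disjoint (block n T b) (block n T c) := by
  rw [Finset.disjoint_left]
  intro i hb hc
  have hb := (Finset.mem_filter.mp hb).2
  have hc := (Finset.mem_filter.mp hc).2
  rcases Nat.lt_or_gt_of_ne h with h | h
  · have := Nat.mul_le_mul_right T h
    rw [Nat.succ_mul] at this
    omega
  · have := Nat.mul_le_mul_right T h
    rw [Nat.succ_mul] at this
    omega

section
variable {n : ℕ} [NeZero n] {A : Finset (Fin n)}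

/-- The `j` sensors following position `i` in the cyclic order. -/
def arcSet (n : ℕ) [NeZero n] (i j : ℕ) : Finset (Fin n) :=
  (Finset.Ioc i (i + j)).image (Fin.ofNat n)

theorem card_arcSet {i j : ℕ} (hj : j ≤ n) : (arcSet n i j).card = j := by
  rw [arcSet, Finset.card_image_of_injOn, Nat.card_Ioc, Nat.add_sub_cancel_left]
  intro a ha b hb hab
  rw [Finset.coe_Ioc, mem_Ioc] at ha hb
  have h : a ≡ b [MOD n] := congrArg Fin.val hab
  refine h.eq_of_abs_lt ?_
  rw [abs_lt]
  omega

theorem EmptyArc.mod {i L : ℕ} (h : EmptyArc A i L) : EmptyArc A (i % n) L := by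
  intro l h1 h2
  have h3 := Nat.div_add_mod i n
  have h4 : Fin.ofNat n l = Fin.ofNat n (n * (i / n) + l) := by ext; simp
  rw [h4]
  exact h _ (by omega) (by omega)

/-- The interior of an arc of length `L` has `L - 1` sensors, so every `j < maxArc A` has some start
`i` whose next `j` sensors all fail. Taking expectations then gives a union bound. -/
theorem maxArc_le_add_sum (A : Finset (Fin n)) (J : ℕ) :
    (maxArc A : ℝ) ≤ J + ∑ j ∈ Finset.Ico J n, ∑ i ∈ Finset.range n,
      if Disjoint A (arcSet n i j) then 1 else 0 := by
  have h0 : ∀ j, 0 ≤ ∑ i ∈ Finset.range n, if Disjoint A (arcSet n i j) then (1 : ℝ) else 0 :=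
    fun j => Finset.sum_nonneg fun i _ => by split_ifs <;> norm_num
  have h1 : ∀ j ∈ Finset.Ico J (maxArc A),
      (1 : ℝ) ≤ ∑ i ∈ Finset.range n, if Disjoint A (arcSet n i j) then 1 else 0 := by
    intro j hj
    obtain ⟨i, hi⟩ := exists_emptyArc_maxArc A
    have hd : Disjoint A (arcSet n (i % n) j) := by
      rw [Finset.disjoint_right]
      intro s hs
      obtain ⟨l, hl, rfl⟩ := Finset.mem_image.mp hs
      rw [Finset.mem_Ioc] at hl
      have := (Finset.mem_Ico.mp hj).2
      exact hi.mod l hl.1 (by omega)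
    have := Finset.single_le_sum (f := fun i => if Disjoint A (arcSet n i j) then (1 : ℝ) else 0)
      (fun i _ => by split_ifs <;> norm_num) (Finset.mem_range.mpr (Nat.mod_lt i (NeZero.pos n)))
    simpa only [if_pos hd] using this
  have h2 := Finset.sum_le_sum h1
  have h3 := Finset.sum_le_sum_of_subset_of_nonneg
    (Finset.Ico_subset_Ico_right (maxArc_le A) : Finset.Ico J (maxArc A) ⊆ Finset.Ico J n)
    fun j _ _ => h0 j
  have h4 : (maxArc A : ℝ) ≤ J + (Finset.Ico J (maxArc A)).card := by
    rw [Nat.card_Ico]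
    exact_mod_cast (by omega : maxArc A ≤ J + (maxArc A - J))
  rw [Finset.sum_const, nsmul_eq_mul, mul_one] at h2
  linarith

theorem expected_maxArc_le {k : ℕ} (hk : k < n) (J : ℕ) :
    ∑ A : Finset (Fin n), constFailProb n k A * maxArc A
      ≤ J + n * (((k : ℝ) / n) ^ J / (1 - (k : ℝ) / n)) := by
  have hn : (0 : ℝ) < n := by exact_mod_cast NeZero.pos n
  have hq : (k : ℝ) / n < 1 := (div_lt_one hn).mpr (by exact_mod_cast hk)
  calc ∑ A : Finset (Fin n), constFailProb n k A * maxArc A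
      ≤ ∑ A : Finset (Fin n), constFailProb n k A * (J + ∑ j ∈ Finset.Ico J n,
          ∑ i ∈ Finset.range n, if Disjoint A (arcSet n i j) then 1 else 0) :=
        Finset.sum_le_sum fun A _ => mul_le_mul_of_nonneg_left (maxArc_le_add_sum A J)
          (constFailProb_nonneg _ _ _)
    _ = J + ∑ j ∈ Finset.Ico J n, ∑ i ∈ Finset.range n, allFailProb n k j := by
        simp only [mul_add, Finset.sum_add_distrib, ← Finset.sum_mul, sum_constFailProb hk.le,
          one_mul, Finset.mul_sum]
        congr 1
        rw [Finset.sum_comm]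
        refine Finset.sum_congr rfl fun j hj => ?_
        rw [Finset.sum_comm]
        refine Finset.sum_congr rfl fun i _ => ?_
        rw [sum_constFailProb_disjoint hk.le, card_arcSet (Finset.mem_Ico.mp hj).2.le]
    _ ≤ J + ∑ j ∈ Finset.Ico J n, n * ((k : ℝ) / n) ^ j := by
        gcongr with j
        rw [Finset.sum_const, Finset.card_range, nsmul_eq_mul]
        exact mul_le_mul_of_nonneg_left (allFailProb_le_pow hk j) hn.le
    _ ≤ _ := by
        rw [← Finset.mul_sum]
        gcongr
        exact geom_sum_Ico_le_of_lt_one (by positivity) hq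

/-- Second moment bound: with `M` disjoint blocks of `T` sensors, an entirely failing block exists
with probability at least `1 - 1 / μ`, where `μ` is the expected number of failing blocks. -/
theorem le_constFailCost_of_blocks {k : ℕ} (hk : k < n) {x : Fin n → ℝ} (hx : x ∈ placements n)
    {T M : ℕ} (hM : M * T ≤ n) (hM0 : 0 < M) (hp : 0 < allFailProb n k T) :
    T * (1 - 1 / (M * allFailProb n k T)) / (2 * n) ≤ constFailCost n k x := by
  classical
  set p := allFailProb n k T with hp'
  set N : Finset (Fin n) → ℝ := fun A =>
    ∑ b ∈ Finset.range M, if Disjoint A (block n T b) then 1 else 0 with hN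
  have hM' : (0 : ℝ) < M := by exact_mod_cast hM0
  have hb : ∀ b ∈ Finset.range M, b * T + T ≤ n := fun b hb => by
    have := Nat.mul_le_mul_right T (Finset.mem_range.mp hb)
    rw [Nat.succ_mul] at this
    omega
  have h1 : ∑ A, constFailProb n k A * N A = M * p := by
    simp only [hN, Finset.mul_sum]
    rw [Finset.sum_comm, Finset.sum_congr rfl fun b h => by
      rw [sum_constFailProb_disjoint hk.le, card_block (hb b h)]]
    simp [hp']
  have h2 : ∑ A, constFailProb n k A * N A ^ 2 ≤ M * p + (M * p) ^ 2 := by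
    have e1 : ∀ A, constFailProb n k A * N A ^ 2 = ∑ b ∈ Finset.range M, ∑ c ∈ Finset.range M,
        constFailProb n k A * (if Disjoint A (block n T b ∪ block n T c) then 1 else 0) := by
      intro A
      rw [sq, Finset.sum_mul_sum, Finset.mul_sum]
      simp only [Finset.mul_sum]
      refine Finset.sum_congr rfl fun b _ => Finset.sum_congr rfl fun c _ => ?_
      by_cases u : Disjoint A (block n T b) <;> by_cases v : Disjoint A (block n T c) <;>
        simp [u, v]
    have e2 : ∀ b ∈ Finset.range M, ∀ c ∈ Finset.range M,
        ∑ A, constFailProb n k A * (if Disjoint A (block n T b ∪ block n T c) then 1 else 0)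
          ≤ (if b = c then p else 0) + p ^ 2 := by
      intro b h c h'
      rw [sum_constFailProb_disjoint hk.le]
      by_cases hbc : b = c
      · subst hbc
        rw [Finset.union_self, card_block (hb b h), if_pos rfl]
        linarith [sq_nonneg p]
      · rw [Finset.card_union_of_disjoint (disjoint_block hbc), card_block (hb b h),
          card_block (hb c h'), if_neg hbc, zero_add, sq]
        exact allFailProb_add_le hk T T
    rw [Finset.sum_congr rfl fun A _ => e1 A, Finset.sum_comm]
    simp only [Finset.sum_comm (s := (Finset.univ : Finset (Finset (Fin n))))]
    refine (Finset.sum_le_sum fun b h => Finset.sum_le_sum fun c h' => e2 b h c h').trans_eq ?_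
    simp only [Finset.sum_add_distrib, Finset.sum_ite_eq, Finset.sum_const, Finset.card_range,
      nsmul_eq_mul]
    rw [Finset.sum_congr rfl fun b h => if_pos h]
    simp
    ring
  have hμ : 0 < M * p := mul_pos hM' hp
  set L : Finset (Fin n) → ℕ := fun A =>
    if ∃ b < M, Disjoint A (block n T b) then T else 0 with hL
  -- The function `1 - (N / μ - 1) ^ 2` is at most `1` and vanishes at `N = 0`, so it minorizes the
  -- indicator of `N > 0`; its mean is `2 - E[N ^ 2] / μ ^ 2`.
  have h3 : ∀ A, T * (1 - (N A / (M * p) - 1) ^ 2) ≤ (L A : ℝ) := by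
    intro A
    by_cases h : ∃ b < M, Disjoint A (block n T b)
    · simp only [hL, if_pos h]
      nlinarith [sq_nonneg (N A / (M * p) - 1), (Nat.cast_nonneg T : (0 : ℝ) ≤ T)]
    · have hN0 : N A = 0 := Finset.sum_eq_zero fun b hbM =>
        if_neg fun hd => h ⟨b, Finset.mem_range.mp hbM, hd⟩
      simp [hL, h, hN0]
  have h4 : T * (1 - 1 / (M * p)) ≤ ∑ A, constFailProb n k A * (L A : ℝ) := by
    have h5 : ∑ A, constFailProb n k A * (T * (1 - (N A / (M * p) - 1) ^ 2))
        = T * (2 * (∑ A, constFailProb n k A * N A) / (M * p)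
          - (∑ A, constFailProb n k A * N A ^ 2) / (M * p) ^ 2) := by
      rw [Finset.mul_sum, Finset.sum_div, Finset.sum_div, ← Finset.sum_sub_distrib, Finset.mul_sum]
      refine Finset.sum_congr rfl fun A _ => ?_
      field_simp
      ring
    refine le_trans ?_ (Finset.sum_le_sum fun A _ =>
      mul_le_mul_of_nonneg_left (h3 A) (constFailProb_nonneg n k A))
    rw [h5, h1]
    refine mul_le_mul_of_nonneg_left ?_ (Nat.cast_nonneg T)
    have h6 := div_le_div_of_nonneg_right h2 (sq_nonneg (M * p))
    have h7 : (M * p + (M * p) ^ 2) / (M * p) ^ 2 = 1 / (M * p) + 1 := by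
      field_simp
    have h8 : 2 * (M * p) / (M * p) = 2 := by field_simp
    rw [h8]
    linarith
  refine le_trans (div_le_div_of_nonneg_right h4 (by positivity))
    (expected_arc_le_constFailCost hk hx L fun A _ => ?_)
  by_cases h : ∃ b < M, Disjoint A (block n T b)
  · simp only [hL, if_pos h]
    obtain ⟨b, hbM, hd⟩ := h
    have hbn := hb b (Finset.mem_range.mpr hbM)
    refine ⟨by omega, b * T, fun l hl1 hl2 hl => ?_⟩
    refine Finset.disjoint_left.mp hd hl (Finset.mem_filter.mpr ⟨Finset.mem_univ _, ?_⟩)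
    rw [Fin.val_ofNat, Nat.mod_eq_of_lt (by omega)]
    omega
  · simp only [hL, if_neg h]
    exact ⟨Nat.zero_le n, 0, fun l _ _ => by omega⟩

theorem equispaced_mem_placements (n : ℕ) : equispaced n ∈ placements n := by
  intro i
  have h : (i : ℝ) + 1 ≤ n := by exact_mod_cast i.2
  have h0 : (0 : ℝ) ≤ i := Nat.cast_nonneg _
  exact ⟨by unfold equispaced; positivity, div_le_one_of_le₀ (by linarith) (by positivity)⟩

theorem constFailCost_equispaced_le_log {k : ℕ} (hk0 : 0 < k) (hk : k < n) {q : ℝ}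
    (hq : (k : ℝ) / n = q) : constFailCost n k (equispaced n) ≤
      1 / (2 * Real.log (1 / q)) * (Real.log n / n) + (2 + q) / (2 * (1 - q)) / n := by
  have hn : (0 : ℝ) < n := by exact_mod_cast NeZero.pos n
  have hk0' : (0 : ℝ) < k := by exact_mod_cast hk0
  have hq0 : 0 < q := hq ▸ by positivity
  have hq1 : q < 1 := hq ▸ (div_lt_one hn).mpr (by exact_mod_cast hk)
  have hl : 0 < Real.log (1 / q) := Real.log_pos (by rw [lt_div_iff₀ hq0]; linarith)
  -- The least integer `J` with `n * q ^ J ≤ 1`, so the union bound beyond `J` contributes a bounded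
  -- amount.
  set J := ⌈Real.log n / Real.log (1 / q)⌉₊ with hJ
  have h1 : Real.log n / Real.log (1 / q) ≤ J := Nat.le_ceil _
  have h2 : (J : ℝ) < Real.log n / Real.log (1 / q) + 1 :=
    Nat.ceil_lt_add_one (div_nonneg (Real.log_natCast_nonneg n) hl.le)
  have h3 : n * q ^ J ≤ 1 := by
    rw [← Real.log_nonpos_iff (by positivity), Real.log_mul hn.ne' (by positivity), Real.log_pow]
    rw [div_le_iff₀ hl, one_div, Real.log_inv] at h1
    linarith
  have h4 := constFailCost_equispaced_le hk
  have h5 := expected_maxArc_le hk J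
  rw [hq, mul_div_assoc'] at h5
  have h6 : n * q ^ J / (1 - q) ≤ 1 / (1 - q) := div_le_div_of_nonneg_right h3 (by linarith)
  have h7 : (k : ℝ) / (n - k) = q / (1 - q) := by
    rw [← hq]
    field_simp
  rw [h7] at h4
  refine h4.trans ?_
  have h8 : 1 / (2 * Real.log (1 / q)) * (Real.log n / n) + (2 + q) / (2 * (1 - q)) / n
      = 1 / (2 * n) * (Real.log n / Real.log (1 / q) + 1 + 1 / (1 - q) + 2 * (q / (1 - q))) := by
    have : 1 - q ≠ 0 := by linarith
    field_simp
    ring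
  rw [h8]
  exact mul_le_mul_of_nonneg_left (by linarith) (by positivity)

end

theorem sq_mul_exp_neg_le {u : ℝ} (hu : 0 ≤ u) : u ^ 2 * Real.exp (-u) ≤ 2 := by
  have h := Real.quadratic_le_exp_of_nonneg hu
  rw [Real.exp_neg, ← div_eq_mul_inv, div_le_iff₀ (Real.exp_pos u)]
  nlinarith

/-- Blocks of length `T ≈ log n / a` fail with probability at least `(q - ε / 2) ^ T ≥ n ^ (-b /
a)`. As `b < a`, the expected number `μ` of failing blocks grows like a power of `n` up to a factor
`1 / T`, which keeps the loss `T / μ` bounded. -/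
theorem exists_le_constFailCost_equispaced {q ε : ℝ} (hε : 0 < ε) (hεq : ε < q) (hq1 : q < 1) :
    ∃ K : ℝ, ∀ n k : ℕ, 0 < k → k < n → (k : ℝ) / n = q →
      1 / (2 * Real.log (1 / (q - ε))) * (Real.log n / n) - K / n
        ≤ constFailCost n k (equispaced n) := by
  set a := Real.log (1 / (q - ε)) with ha
  set b := Real.log (1 / (q - ε / 2)) with hb
  have hb0 : 0 < b := Real.log_pos (by rw [lt_div_iff₀ (by linarith)]; linarith)
  have hba : b < a := Real.log_lt_log (by apply one_div_pos.mpr; linarith)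
    (one_div_lt_one_div_of_lt (by linarith) (by linarith))
  have ha0 : 0 < a := hb0.trans hba
  -- The terms pay respectively for rounding `T`, for the small `n` with `T > ε * n / 2`, and for
  -- the loss `T / μ`.
  refine ⟨1 + 4 / (a ^ 2 * ε) + 4 / (a - b) ^ 2, fun n k hk0 hk hq => ?_⟩
  have : NeZero n := ⟨by omega⟩
  have hn : (0 : ℝ) < n := by exact_mod_cast NeZero.pos n
  have hC0 : 0 ≤ constFailCost n k (equispaced n) := by
    unfold constFailCost expectedCost
    exact Finset.sum_nonneg fun A _ => mul_nonneg (constFailProb_nonneg _ _ _) (coverageCost_nonneg _ _)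
  have hlog := Real.log_natCast_nonneg n
  have hab : 0 < a - b := sub_pos.mpr hba
  have hK1 : 0 ≤ 4 / (a ^ 2 * ε) := by positivity
  have hK2 : 0 ≤ 4 / (a - b) ^ 2 := by positivity
  set T := ⌊Real.log n / a⌋₊ with hT
  have hT1 : (T : ℝ) ≤ Real.log n / a := Nat.floor_le (by positivity)
  have hT2 : Real.log n / a < T + 1 := Nat.lt_floor_add_one _
  have e1 : 1 / (2 * a) * (Real.log n / n) - (1 + 4 / (a ^ 2 * ε) + 4 / (a - b) ^ 2) / n
      = (Real.log n / a - 2 * (1 + 4 / (a ^ 2 * ε) + 4 / (a - b) ^ 2)) / (2 * n) := by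
    field_simp
  rw [e1]
  rcases Nat.eq_zero_or_pos T with h0 | hTpos
  · refine le_trans (div_nonpos_of_nonpos_of_nonneg ?_ (by positivity)) hC0
    rw [h0] at hT2
    push_cast at hT2
    linarith
  -- If `T` is large compared with `n`, then `log n ≤ 2 * √n` bounds `n` and the claimed lower bound
  -- is not positive.
  rcases lt_or_ge (ε / 2 * n) T with hlarge | hsmall
  · refine le_trans (div_nonpos_of_nonpos_of_nonneg ?_ (by positivity)) hC0
    have hs := Real.sqrt_pos.mpr hn
    have hsq := Real.sq_sqrt hn.le
    have h1 : Real.log n ≤ 2 * √n := by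
      have := Real.log_le_sub_one_of_pos hs
      rw [Real.log_sqrt hn.le] at this
      linarith
    have h2 : ε / 2 * n < 2 * √n / a :=
      hlarge.trans_le (hT1.trans (div_le_div_of_nonneg_right h1 ha0.le))
    have h3 : √n ≤ 4 / (ε * a) := by
      rw [lt_div_iff₀ ha0] at h2
      rw [le_div_iff₀ (by positivity)]
      nlinarith
    have h4 : Real.log n / a ≤ 8 / (a ^ 2 * ε) := by
      calc Real.log n / a ≤ 2 * (4 / (ε * a)) / a := by gcongr; linarith
        _ = 8 / (a ^ 2 * ε) := by field_simp; norm_num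
    have h5 : 8 / (a ^ 2 * ε) = 2 * (4 / (a ^ 2 * ε)) := by ring
    linarith
  · have hβ : 0 < q - ε / 2 := by linarith
    have hTpos' : (0 : ℝ) < T := by exact_mod_cast hTpos
    have hTn : T ≤ n := by
      have : (T : ℝ) ≤ n := by nlinarith
      exact_mod_cast this
    have hp := pow_le_allFailProb hk (T := T) hβ.le
      (by rw [sub_div, hq]; linarith [(div_le_iff₀ hn).mpr hsmall]) le_rfl
    have hp0 : 0 < allFailProb n k T := (pow_pos hβ T).trans_le hp
    set M := n / T with hM
    have hM0 : 0 < M := Nat.div_pos hTn hTpos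
    have hM0' : (0 : ℝ) < M := by exact_mod_cast hM0
    have hM1 : (n : ℝ) ≤ 2 * (M * T) := by
      have h1 := Nat.div_add_mod n T
      have h2 := Nat.mod_lt n hTpos
      have h3 : T ≤ T * M := Nat.le_mul_of_pos_right T hM0
      rw [← hM] at h1
      have h4 : n ≤ 2 * (M * T) := by rw [mul_comm M T]; omega
      exact_mod_cast h4
    have key := le_constFailCost_of_blocks hk (equispaced_mem_placements n)
      (Nat.div_mul_le_self n T) hM0 hp0
    refine le_trans (div_le_div_of_nonneg_right ?_ (by positivity)) key
    have hpow : Real.exp (-(b / a * Real.log n)) ≤ (q - ε / 2) ^ T := by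
      rw [← Real.exp_log (pow_pos hβ T), Real.log_pow]
      refine Real.exp_le_exp.mpr ?_
      have : Real.log (q - ε / 2) = -b := by rw [hb, one_div, Real.log_inv, neg_neg]
      rw [this]
      have : b * T ≤ b * (Real.log n / a) := mul_le_mul_of_nonneg_left hT1 hb0.le
      have h2 : b / a * Real.log n = b * (Real.log n / a) := by ring
      linarith
    set u := (a - b) / a * Real.log n with hu
    have hu0 : 0 ≤ u := by positivity
    have hexp : Real.exp u ≤ n * (q - ε / 2) ^ T := by
      calc Real.exp u = n * Real.exp (-(b / a * Real.log n)) := by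
            have h1 : u = Real.log n + -(b / a * Real.log n) := by
              rw [hu]
              field_simp
              ring
            rw [h1, Real.exp_add, Real.exp_log hn]
        _ ≤ _ := mul_le_mul_of_nonneg_left hpow hn.le
    have hTu : (T : ℝ) ≤ u / (a - b) := by
      refine hT1.trans_eq ?_
      rw [hu]
      field_simp
    -- With `T ≤ u / (a - b)` and `μ ≥ exp u / (2T)`, the loss is at most `2 * u ^ 2 * exp (-u) / (a
    -- - b) ^ 2`, and `u ^ 2 * exp (-u) ≤ 2`.
    have hbound : T * (1 / (M * allFailProb n k T)) ≤ 4 / (a - b) ^ 2 := by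
      have h1 : Real.exp u ≤ 2 * T * (M * allFailProb n k T) := by
        calc Real.exp u ≤ n * (q - ε / 2) ^ T := hexp
          _ ≤ 2 * (M * T) * allFailProb n k T :=
            mul_le_mul hM1 hp (pow_nonneg hβ.le T) (by positivity)
          _ = _ := by ring
      have h2 := sq_mul_exp_neg_le hu0
      rw [Real.exp_neg, ← div_eq_mul_inv, div_le_iff₀ (Real.exp_pos u)] at h2
      have h3 : (T * (a - b)) ^ 2 ≤ u ^ 2 := by
        have := (le_div_iff₀ hab).mp hTu
        exact pow_le_pow_left₀ (by positivity) this 2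
      rw [mul_one_div, div_le_div_iff₀ (by positivity) (by positivity)]
      have h4 : T * (T * (a - b) ^ 2) ≤ T * (4 * (M * allFailProb n k T)) := by nlinarith
      exact le_of_mul_le_mul_left h4 hTpos'
    linarith

theorem equispaced_bounds {q ε : ℝ} (hε : 0 < ε) (hεq : ε < min q (1 - q)) :
    ∃ K : ℝ, ∀ n k : ℕ, 0 < k → k < n → (k : ℝ) / n = q →
      1 / (2 * Real.log (n / (k - n * ε))) * (Real.log n / n) - K / n
        ≤ constFailCost n k (equispaced n) ∧
      constFailCost n k (equispaced n)
        ≤ 1 / (2 * Real.log (n / (k + n * ε))) * (Real.log n / n) + K / n := by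
  obtain ⟨h1, h2⟩ := lt_min_iff.mp hεq
  obtain ⟨K, hK⟩ := exists_le_constFailCost_equispaced hε h1 (by linarith)
  refine ⟨max K ((2 + q) / (2 * (1 - q))), fun n k hk0 hk hq => ?_⟩
  have : NeZero n := ⟨by omega⟩
  have hn : (0 : ℝ) < n := by exact_mod_cast NeZero.pos n
  have hkq : (k : ℝ) = q * n := by rw [← hq]; field_simp
  have e1 : (n : ℝ) / (k - n * ε) = 1 / (q - ε) := by
    rw [hkq, mul_comm q, ← mul_sub, ← div_div, div_self hn.ne']
  have e2 : (n : ℝ) / (k + n * ε) = 1 / (q + ε) := by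
    rw [hkq, mul_comm q, ← mul_add, ← div_div, div_self hn.ne']
  rw [e1, e2]
  constructor
  · refine le_trans (sub_le_sub_left ?_ _) (hK n k hk0 hk hq)
    gcongr
    exact le_max_left _ _
  · refine (constFailCost_equispaced_le_log hk0 hk hq).trans (add_le_add ?_ ?_)
    · refine mul_le_mul_of_nonneg_right ?_ (div_nonneg (Real.log_natCast_nonneg n) hn.le)
      have h3 : 0 < Real.log (1 / (q + ε)) :=
        Real.log_pos (by rw [lt_div_iff₀ (by linarith)]; linarith)
      refine one_div_le_one_div_of_le (by linarith) ?_
      exact mul_le_mul_of_nonneg_left (Real.log_le_log (one_div_pos.mpr (by linarith))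
        (one_div_le_one_div_of_le (by linarith) (by linarith))) (by norm_num)
    · gcongr
      exact le_max_right _ _

theorem equispaced_isEquivalent {q : ℝ} (hq0 : 0 < q) (hq1 : q < 1) {n k : ℕ → ℕ}
    (hn : Tendsto n atTop atTop) (hk : ∀ j, (k j : ℝ) / n j = q) :
    (fun j => constFailCost (n j) (k j) (equispaced (n j))) ~[atTop]
      fun j => 1 / (2 * Real.log ((n j : ℝ) / k j)) * (Real.log (n j) / n j) := by
  set D := 1 / (2 * Real.log (1 / q)) with hD
  have hl : 0 < Real.log (1 / q) := Real.log_pos (by rw [lt_div_iff₀ hq0]; linarith)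
  have hD0 : 0 < D := by positivity
  have e : ∀ j, (n j : ℝ) / k j = 1 / q := fun j => by rw [← hk j, one_div_div]
  simp only [e]
  refine isLittleO_iff.mpr fun c hc => ?_
  have hcont : ContinuousAt (fun ε : ℝ => 1 / (2 * Real.log (1 / (q - ε)))) 0 := by
    have h1 : 1 / (q - (0 : ℝ)) ≠ 0 := by rw [sub_zero]; positivity
    have h2 : 2 * Real.log (1 / (q - (0 : ℝ))) ≠ 0 := by rw [sub_zero]; positivity
    have h3 : q - (0 : ℝ) ≠ 0 := by rw [sub_zero]; positivity
    fun_prop (disch := assumption)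
  -- Half of the tolerance `c` goes to choosing `ε`, by continuity at `0`; the other half absorbs `K
  -- / n` once `log n` is large.
  have hev : ∀ᶠ ε in 𝓝[>] (0 : ℝ), (1 - c / 2) * D < 1 / (2 * Real.log (1 / (q - ε))) := by
    refine (hcont.eventually_const_lt ?_).filter_mono nhdsWithin_le_nhds
    simp only [sub_zero, ← hD]
    nlinarith
  obtain ⟨ε, h1, hε, hεq⟩ := (hev.and (Ioo_mem_nhdsGT hq0)).exists
  obtain ⟨K, hK⟩ := exists_le_constFailCost_equispaced hε hεq hq1
  have hlog : Tendsto (fun j => Real.log (n j)) atTop atTop :=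
    Real.tendsto_log_atTop.comp (tendsto_natCast_atTop_atTop.comp hn)
  filter_upwards [hn.eventually_ge_atTop 1, hlog.eventually_ge_atTop (2 * K / (c * D)),
    hlog.eventually_ge_atTop ((2 + q) / (2 * (1 - q)) / (c * D))] with j hj hj1 hj2
  have : NeZero (n j) := ⟨by omega⟩
  have hnj : (0 : ℝ) < n j := by exact_mod_cast hj
  have hkj : (k j : ℝ) = q * n j := by rw [← hk j]; field_simp
  have hkj0 : 0 < k j := by
    have : (0 : ℝ) < k j := hkj ▸ mul_pos hq0 hnj
    exact_mod_cast this
  have hkj1 : k j < n j := by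
    have : (k j : ℝ) < n j := by rw [hkj]; nlinarith
    exact_mod_cast this
  have hlo := hK _ _ hkj0 hkj1 (hk j)
  have hup := constFailCost_equispaced_le_log hkj0 hkj1 (hk j)
  have hlog0 : 0 ≤ Real.log (n j) / n j := div_nonneg (Real.log_natCast_nonneg _) hnj.le
  rw [div_le_iff₀ (by positivity)] at hj1 hj2
  have hj1' := div_le_div_of_nonneg_right hj1 hnj.le
  have hj2' := div_le_div_of_nonneg_right hj2 hnj.le
  have e1 : 2 * K / n j = 2 * (K / n j) := by ring
  have e2 : Real.log (n j) * (c * D) / n j = c * (D * (Real.log (n j) / n j)) := by ring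
  rw [e2] at hj1' hj2'
  have h1' := mul_le_mul_of_nonneg_right h1.le hlog0
  rw [Pi.sub_apply, Real.norm_eq_abs, Real.norm_of_nonneg (mul_nonneg hD0.le hlog0), abs_le]
  constructor
  · have e3 : (1 - c / 2) * D * (Real.log (n j) / n j) = D * (Real.log (n j) / n j)
        - c * (D * (Real.log (n j) / n j)) / 2 := by ring
    linarith
  · linarith

/-! ### Random placement: law and second moment of the number of large gaps -/

section

/-- The uniform distribution on `[0,1]`. -/
noncomputable abbrev unitMeasure : Measure ℝ := volume.restrict (Icc (0 : ℝ) 1)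

instance : IsProbabilityMeasure unitMeasure := ⟨by simp⟩

instance (n : ℕ) : IsProbabilityMeasure (randomPlacement n) := by
  unfold randomPlacement; infer_instance

variable {n : ℕ} {A : Finset (Fin n)}

theorem ae_mem_placements (n : ℕ) : ∀ᵐ x ∂randomPlacement n, x ∈ placements n := by
  have h : randomPlacement n
      = (Measure.pi fun _ : Fin n => (volume : Measure ℝ)).restrict
        (Set.pi univ fun _ => Icc (0 : ℝ) 1) := by
    rw [Measure.restrict_pi_pi, randomPlacement]
  rw [h]
  filter_upwards [ae_restrict_mem (MeasurableSet.univ_pi fun _ => measurableSet_Icc)] with x hx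
  exact fun i => hx i (mem_univ i)

theorem integrable_coverageCost (A : Finset (Fin n)) :
    Integrable (fun x => coverageCost x A) (randomPlacement n) := by
  refine Integrable.of_bound
    (lipschitzWith_coverageCost A).continuous.measurable.aestronglyMeasurable 1 ?_
  filter_upwards [ae_mem_placements n] with x hx
  rw [Real.norm_of_nonneg (coverageCost_nonneg x A)]
  exact coverageCost_le_one hx

theorem measureReal_forall_notMem (A : Finset (Fin n)) {S : Set ℝ} (hS : MeasurableSet S) :
    (randomPlacement n).real {x | ∀ j ∈ A, x j ∉ S} = (1 - unitMeasure.real S) ^ A.card := by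
  have h : {x : Fin n → ℝ | ∀ j ∈ A, x j ∉ S} = Set.pi (A : Set (Fin n)) fun _ => Sᶜ := by
    ext x; rfl
  rw [h, measureReal_def, randomPlacement, Measure.pi_pi_finset, Finset.prod_const,
    ENNReal.toReal_pow, ← measureReal_def, probReal_compl_eq_one_sub hS]

theorem measureReal_Icc_of_subset {a b : ℝ} (ha : 0 ≤ a) (hab : a ≤ b) (hb : b ≤ 1) :
    unitMeasure.real (Icc a b) = b - a := by
  rw [measureReal_restrict_apply measurableSet_Icc,
    inter_eq_left.mpr (Icc_subset_Icc ha hb), Real.volume_real_Icc_of_le hab]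

theorem measureReal_Ico_of_subset {a b : ℝ} (ha : 0 ≤ a) (hab : a ≤ b) (hb : b ≤ 1) :
    unitMeasure.real (Ico a b) = b - a := by
  rw [measureReal_restrict_apply measurableSet_Ico,
    inter_eq_left.mpr (Ico_subset_Icc_self.trans (Icc_subset_Icc ha hb)),
    Real.volume_real_Ico_of_le hab]

/-- Resampling one coordinate of the random placement does not change its law. -/
theorem randomPlacement_apply_update (i : Fin n) {S : Set (Fin n → ℝ)} (hS : MeasurableSet S) :
    randomPlacement n S
      = ∫⁻ y, randomPlacement n {x | Function.update x i y ∈ S} ∂unitMeasure := by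
  have hf : Measurable fun p : (Fin n → ℝ) × ℝ => Function.update p.1 i p.2 := by
    refine measurable_pi_lambda _ fun j => ?_
    by_cases h : j = i
    · subst h
      simpa using measurable_snd
    · simp only [Function.update_of_ne h]
      exact (measurable_pi_apply j).comp measurable_fst
  have h : randomPlacement n = ((randomPlacement n).prod unitMeasure).map
      fun p => Function.update p.1 i p.2 := by
    unfold randomPlacement
    refine Measure.pi_eq fun s hs => ?_
    have hpre : (fun p : (Fin n → ℝ) × ℝ => Function.update p.1 i p.2) ⁻¹' Set.pi univ s
        = Set.pi univ (Function.update s i univ) ×ˢ s i := by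
      ext ⟨x, y⟩
      simp only [mem_preimage, mem_univ_pi, mem_prod]
      constructor
      · intro h
        refine ⟨fun j => ?_, by simpa using h i⟩
        by_cases hj : j = i
        · subst hj; simp
        · simpa [Function.update_of_ne hj] using h j
      · rintro ⟨h1, h2⟩ j
        by_cases hj : j = i
        · subst hj; simpa using h2
        · simpa [Function.update_of_ne hj] using h1 j
    rw [Measure.map_apply hf (MeasurableSet.univ_pi hs), hpre, Measure.prod_prod, Measure.pi_pi,
      ← Finset.mul_prod_erase _ _ (Finset.mem_univ i), ← Finset.mul_prod_erase _ _
        (Finset.mem_univ i), Function.update_self, measure_univ, one_mul, mul_comm]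
    congr 1
    refine Finset.prod_congr rfl fun j hj => ?_
    rw [Function.update_of_ne (Finset.ne_of_mem_erase hj)]
  conv_lhs => rw [h, Measure.map_apply hf hS, Measure.prod_apply_symm (hf hS)]
  rfl

theorem measureReal_le_of_update (i : Fin n) {S : Set (Fin n → ℝ)} (hS : MeasurableSet S) {c : ℝ}
    (hc : 0 ≤ c) (h : ∀ y, (randomPlacement n).real {x | Function.update x i y ∈ S} ≤ c) :
    (randomPlacement n).real S ≤ c := by
  rw [measureReal_def, randomPlacement_apply_update i hS]
  refine ENNReal.toReal_le_of_le_ofReal hc ?_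
  calc ∫⁻ y, randomPlacement n {x | Function.update x i y ∈ S} ∂unitMeasure
      ≤ ∫⁻ _, ENNReal.ofReal c ∂unitMeasure := by
        refine lintegral_mono fun y => ?_
        rw [← ofReal_measureReal]
        exact ENNReal.ofReal_le_ofReal (h y)
    _ = ENNReal.ofReal c := by simp

/-- Sensor `i` is followed by a gap of length at least `d` free of other active sensors. -/
def gapEvent (A : Finset (Fin n)) (d : ℝ) (i : Fin n) : Set (Fin n → ℝ) :=
  {x | x i ∈ Icc 0 (1 - d) ∧ ∀ l ∈ A.erase i, x l ∉ Ico (x i) (x i + d)}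

theorem measurableSet_gapEvent (A : Finset (Fin n)) (d : ℝ) (i : Fin n) :
    MeasurableSet (gapEvent A d i) := by
  have h : gapEvent A d i = (fun x : Fin n → ℝ => x i) ⁻¹' Icc 0 (1 - d) ∩
      ⋂ l ∈ A.erase i, ({x : Fin n → ℝ | x i ≤ x l} ∩ {x | x l < x i + d})ᶜ := by
    ext x
    simp [gapEvent, mem_iInter]
  rw [h]
  refine (measurable_pi_apply i measurableSet_Icc).inter
    (Finset.measurableSet_biInter _ fun l _ => MeasurableSet.compl ?_)
  exact (measurableSet_le (measurable_pi_apply i) (measurable_pi_apply l)).inter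
    (measurableSet_lt (by fun_prop) (by fun_prop))

theorem half_le_coverageCost_of_gapEvent {d : ℝ} (hd : 0 ≤ d) {i : Fin n} (hi : i ∈ A)
    {x : Fin n → ℝ} (hx : x ∈ gapEvent A d i) : d / 2 ≤ coverageCost x A := by
  have h := half_gap_le_coverageCost (x := x) (a := x i) (b := x i + d) ⟨i, hi⟩ hx.1.1
    (by linarith [hx.1.2]) (by linarith) fun j hj => by
      by_cases hji : j = i
      · exact Or.inl (by rw [hji])
      · have := hx.2 j (Finset.mem_erase.mpr ⟨hji, hj⟩)
        by_contra! hc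
        exact this ⟨hc.1.le, hc.2⟩
  linarith

/-- Condition on `x i = y`: it lies in `[0, 1 - d]` with probability `1 - d`, and then each of the
other `A.card - 1` active sensors independently avoids a window of length `d`. -/
theorem measureReal_gapEvent {d : ℝ} (hd0 : 0 ≤ d) (hd1 : d ≤ 1) {i : Fin n} (hi : i ∈ A) :
    (randomPlacement n).real (gapEvent A d i) = (1 - d) ^ A.card := by
  have h : ∀ y, randomPlacement n {x | Function.update x i y ∈ gapEvent A d i}
      = (Icc (0 : ℝ) (1 - d)).indicator
        (fun _ => ENNReal.ofReal ((1 - d) ^ (A.card - 1))) y := by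
    intro y
    by_cases hy : y ∈ Icc 0 (1 - d)
    · have hset : {x | Function.update x i y ∈ gapEvent A d i}
          = {x : Fin n → ℝ | ∀ l ∈ A.erase i, x l ∉ Ico y (y + d)} := by
        ext x
        simp only [gapEvent, mem_ofPred_eq, Function.update_self, hy, true_and]
        refine forall₂_congr fun l hl => ?_
        rw [Function.update_of_ne (Finset.ne_of_mem_erase hl)]
      rw [indicator_of_mem hy, hset, ← ofReal_measureReal,
        measureReal_forall_notMem _ measurableSet_Ico, Finset.card_erase_of_mem hi,
        measureReal_Ico_of_subset hy.1 (by linarith) (by linarith [hy.2]), add_sub_cancel_left]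
    · have hset : {x | Function.update x i y ∈ gapEvent A d i} = ∅ := by
        refine eq_empty_of_forall_notMem fun x hx => hy ?_
        have := hx.1
        rwa [Function.update_self] at this
      rw [hset, indicator_of_notMem hy, measure_empty]
  have hc : A.card = A.card - 1 + 1 := (Nat.succ_pred_eq_of_pos (Finset.card_pos.mpr ⟨i, hi⟩)).symm
  rw [measureReal_def, randomPlacement_apply_update i (measurableSet_gapEvent A d i),
    lintegral_congr h, lintegral_indicator_const measurableSet_Icc, ENNReal.toReal_mul,
    ENNReal.toReal_ofReal (pow_nonneg (by linarith) _), ← measureReal_def,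
    measureReal_Icc_of_subset le_rfl (by linarith) (by linarith), sub_zero, ← pow_succ, ← hc]

/-- Condition on both positions. Neither window contains the left end of the other, so they are
disjoint, and the remaining active sensors avoid a set of measure `2 * d`. -/
theorem measureReal_gapEvent_inter_le {d : ℝ} (hd0 : 0 ≤ d) (hd1 : 2 * d ≤ 1) {i j : Fin n}
    (hi : i ∈ A) (hj : j ∈ A) (hij : i ≠ j) :
    (randomPlacement n).real (gapEvent A d i ∩ gapEvent A d j) ≤ (1 - 2 * d) ^ (A.card - 2) := by
  have hm := (measurableSet_gapEvent A d i).inter (measurableSet_gapEvent A d j)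
  have hc : 0 ≤ (1 - 2 * d) ^ (A.card - 2) := pow_nonneg (by linarith) _
  refine measureReal_le_of_update i hm hc fun y => ?_
  have hu : Measurable fun x : Fin n → ℝ => Function.update x i y := measurable_update_left
  have hm' : MeasurableSet
      {x : Fin n → ℝ | Function.update x i y ∈ gapEvent A d i ∩ gapEvent A d j} :=
    hu hm
  refine measureReal_le_of_update j hm' hc fun z => ?_
  set E := {x : Fin n → ℝ | Function.update x j z ∈
    {x : Fin n → ℝ | Function.update x i y ∈ gapEvent A d i ∩ gapEvent A d j}} with hE
  rcases E.eq_empty_or_nonempty with h0 | ⟨x₀, h₀⟩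
  · rw [h0, measureReal_empty]
    exact hc
  have hsub : ∀ x ∈ E, (y ∈ Icc 0 (1 - d) ∧ z ∈ Icc 0 (1 - d) ∧ z ∉ Ico y (y + d) ∧
      y ∉ Ico z (z + d)) ∧ ∀ l ∈ (A.erase i).erase j, x l ∉ Ico y (y + d) ∪ Ico z (z + d) := by
    rintro x ⟨⟨h1, h2⟩, h3, h4⟩
    simp only [Function.update_self, Function.update_of_ne hij.symm] at h1 h2 h3 h4
    have h5 := h2 j (Finset.mem_erase.mpr ⟨hij.symm, hj⟩)
    have h6 := h4 i (Finset.mem_erase.mpr ⟨hij, hi⟩)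
    simp only [Function.update_self, Function.update_of_ne hij.symm] at h5 h6
    refine ⟨⟨h1, h3, h5, h6⟩, fun l hl => ?_⟩
    obtain ⟨hlj, hl'⟩ := Finset.mem_erase.mp hl
    obtain ⟨hli, hlA⟩ := Finset.mem_erase.mp hl'
    have h7 := h2 l hl'
    have h8 := h4 l (Finset.mem_erase.mpr ⟨hlj, hlA⟩)
    simp only [Function.update_of_ne hli, Function.update_of_ne hlj] at h7 h8
    exact fun h => h.elim h7 h8
  obtain ⟨⟨hy, hz, hyz, hzy⟩, -⟩ := hsub x₀ h₀
  have hdisj : Disjoint (Ico y (y + d)) (Ico z (z + d)) := by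
    rw [Ico_disjoint_Ico]
    simp only [mem_Ico, not_and, not_lt] at hyz hzy
    rcases le_total y z with h | h
    · exact (min_le_left _ _).trans ((hyz h).trans (le_max_right _ _))
    · exact (min_le_right _ _).trans ((hzy h).trans (le_max_left _ _))
  refine (measureReal_mono fun x hx => (hsub x hx).2).trans_eq ?_
  have hcard : ((A.erase i).erase j).card = A.card - 2 := by
    rw [Finset.card_erase_of_mem (Finset.mem_erase.mpr ⟨hij.symm, hj⟩),
      Finset.card_erase_of_mem hi]
    omega
  have hmeas := measureReal_forall_notMem ((A.erase i).erase j)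
    (measurableSet_Ico.union measurableSet_Ico : MeasurableSet (Ico y (y + d) ∪ Ico z (z + d)))
  refine hmeas.trans ?_
  rw [hcard, measureReal_union hdisj measurableSet_Ico,
    measureReal_Ico_of_subset hy.1 (by linarith) (by linarith [hy.2]),
    measureReal_Ico_of_subset hz.1 (by linarith) (by linarith [hz.2])]
  congr 1
  ring

/-- Second moment bound for the existence of a gap of length `d`. -/
theorem le_measureReal_coverageCost {d : ℝ} (hd0 : 0 ≤ d) (hd1 : 2 * d ≤ 1) (hA : 2 ≤ A.card) :
    1 - 1 / (A.card * (1 - d) ^ A.card) - (1 / (1 - d) ^ 4 - 1)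
      ≤ (randomPlacement n).real {x | d / 2 ≤ coverageCost x A} := by
  set m := A.card with hm
  set p := (1 - d) ^ m with hp
  have h1d : 0 < 1 - d := by linarith
  have hp0 : 0 < p := pow_pos h1d m
  have hm0 : (0 : ℝ) < m := by exact_mod_cast (by omega : 0 < m)
  have hμ : 0 < m * p := mul_pos hm0 hp0
  set N : (Fin n → ℝ) → ℝ := fun x => ∑ i ∈ A, (gapEvent A d i).indicator 1 x with hN
  have hint : ∀ S : Set (Fin n → ℝ), MeasurableSet S →
      Integrable (S.indicator (1 : (Fin n → ℝ) → ℝ)) (randomPlacement n) := fun S hS =>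
    (integrable_const (1 : ℝ)).indicator hS
  have hNint : Integrable N (randomPlacement n) :=
    integrable_finsetSum _ fun i _ => hint _ (measurableSet_gapEvent A d i)
  have hN2 : ∀ x, N x ^ 2 = ∑ i ∈ A, ∑ j ∈ A,
      (gapEvent A d i ∩ gapEvent A d j).indicator (1 : (Fin n → ℝ) → ℝ) x := by
    intro x
    simp only [hN, sq, Finset.sum_mul_sum, inter_indicator_one, Pi.mul_apply]
  have hmi : ∀ i j, MeasurableSet (gapEvent A d i ∩ gapEvent A d j) := fun i j =>
    (measurableSet_gapEvent A d i).inter (measurableSet_gapEvent A d j)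
  have hN2int : Integrable (fun x => N x ^ 2) (randomPlacement n) := by
    simp only [hN2]
    exact integrable_finsetSum _ fun i _ => integrable_finsetSum _ fun j _ => hint _ (hmi i j)
  have hEN : ∫ x, N x ∂randomPlacement n = m * p := by
    simp only [hN]
    rw [integral_finsetSum _ fun i _ => hint _ (measurableSet_gapEvent A d i)]
    rw [Finset.sum_congr rfl fun i hi => by
      rw [integral_indicator_one (measurableSet_gapEvent A d i),
        measureReal_gapEvent hd0 (by linarith) hi]]
    simp [hp, hm]
  have hEN2 : ∫ x, N x ^ 2 ∂randomPlacement n ≤ m * p + m ^ 2 * (1 - 2 * d) ^ (m - 2) := by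
    simp only [hN2]
    rw [integral_finsetSum _ fun i _ => integrable_finsetSum _ fun j _ => hint _ (hmi i j)]
    have hij : ∀ i ∈ A, ∀ j ∈ A, (randomPlacement n).real (gapEvent A d i ∩ gapEvent A d j)
        ≤ (if i = j then p else 0) + (1 - 2 * d) ^ (m - 2) := by
      intro i hi j hj
      by_cases h : i = j
      · subst h
        rw [inter_self, measureReal_gapEvent hd0 (by linarith) hi, if_pos rfl]
        linarith [pow_nonneg (by linarith : 0 ≤ 1 - 2 * d) (m - 2)]
      · rw [if_neg h, zero_add]
        exact measureReal_gapEvent_inter_le hd0 hd1 hi hj h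
    calc _ = ∑ i ∈ A, ∑ j ∈ A, (randomPlacement n).real (gapEvent A d i ∩ gapEvent A d j) := by
          refine Finset.sum_congr rfl fun i _ => ?_
          rw [integral_finsetSum _ fun j _ => hint _ (hmi i j)]
          exact Finset.sum_congr rfl fun j _ => integral_indicator_one (hmi i j)
      _ ≤ ∑ i ∈ A, ∑ j ∈ A, ((if i = j then p else 0) + (1 - 2 * d) ^ (m - 2)) :=
          Finset.sum_le_sum fun i hi => Finset.sum_le_sum fun j hj => hij i hi j hj
      _ = _ := by
          simp only [Finset.sum_add_distrib, Finset.sum_ite_eq, Finset.sum_const, nsmul_eq_mul]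
          rw [Finset.sum_congr rfl fun i hi => if_pos hi]
          simp [← hm]
          ring
  have hpt : ∀ x, 2 * N x / (m * p) - N x ^ 2 / (m * p) ^ 2
      ≤ {x | d / 2 ≤ coverageCost x A}.indicator (1 : (Fin n → ℝ) → ℝ) x := by
    intro x
    by_cases h : d / 2 ≤ coverageCost x A
    · rw [indicator_of_mem (show x ∈ {x | d / 2 ≤ coverageCost x A} from h), Pi.one_apply]
      have : 2 * N x / (m * p) - N x ^ 2 / (m * p) ^ 2 = 1 - (N x / (m * p) - 1) ^ 2 := by
        field_simp
        ring
      rw [this]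
      linarith [sq_nonneg (N x / (m * p) - 1)]
    · have h0 : N x = 0 := Finset.sum_eq_zero fun i hi =>
        indicator_of_notMem (fun hx => h (half_le_coverageCost_of_gapEvent hd0 hi hx)) _
      rw [h0, indicator_of_notMem (show x ∉ {x | d / 2 ≤ coverageCost x A} from h)]
      simp
  have hS : MeasurableSet {x : Fin n → ℝ | d / 2 ≤ coverageCost x A} :=
    measurableSet_le measurable_const (lipschitzWith_coverageCost A).continuous.measurable
  have hmono := integral_mono (((hNint.const_mul 2).div_const (m * p)).sub
    (hN2int.div_const ((m * p) ^ 2))) (hint _ hS) hpt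
  rw [integral_indicator_one hS] at hmono
  refine le_trans ?_ hmono
  simp only [Pi.sub_apply]
  rw [integral_sub ((hNint.const_mul 2).div_const _) (hN2int.div_const _), integral_div,
    integral_div, integral_const_mul, hEN]
  have e1 : 2 * (m * p) / (m * p) = 2 := by field_simp
  have e2 := div_le_div_of_nonneg_right hEN2 (sq_nonneg (m * p))
  -- Since `1 - 2 * d ≤ (1 - d) ^ 2`, the pairs are almost uncorrelated; the two sensors missing
  -- from the exponent cost `(1 - d) ^ (-4)`.
  have e3 : m ^ 2 * (1 - 2 * d) ^ (m - 2) / (m * p) ^ 2 ≤ 1 / (1 - d) ^ 4 := by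
    have h1 : (1 - 2 * d) ^ (m - 2) ≤ ((1 - d) ^ 2) ^ (m - 2) :=
      pow_le_pow_left₀ (by linarith) (by nlinarith) _
    have h2 : ((1 - d) ^ 2) ^ (m - 2) * (1 - d) ^ 4 = p ^ 2 := by
      rw [← pow_mul, ← pow_add, hp, ← pow_mul]
      congr 1
      omega
    rw [div_le_div_iff₀ (by positivity) (by positivity), one_mul, mul_pow, mul_assoc]
    refine mul_le_mul_of_nonneg_left ?_ (by positivity)
    rw [← h2]
    exact mul_le_mul_of_nonneg_right h1 (by positivity)
  have e4 : (m * p + m ^ 2 * (1 - 2 * d) ^ (m - 2)) / (m * p) ^ 2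
      = 1 / (m * p) + m ^ 2 * (1 - 2 * d) ^ (m - 2) / (m * p) ^ 2 := by
    rw [add_div]
    congr 1
    field_simp
  rw [e4] at e2
  rw [e1]
  linarith

end

/-! ### Random placement: tail sums and expected cost -/

section

variable {n : ℕ} {A : Finset (Fin n)}

theorem measurableSet_lt_coverageCost (A : Finset (Fin n)) (c : ℝ) :
    MeasurableSet {x : Fin n → ℝ | c < coverageCost x A} :=
  measurableSet_lt measurable_const (lipschitzWith_coverageCost A).continuous.measurable

theorem measurableSet_le_coverageCost (A : Finset (Fin n)) (c : ℝ) :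
    MeasurableSet {x : Fin n → ℝ | c ≤ coverageCost x A} :=
  measurableSet_le measurable_const (lipschitzWith_coverageCost A).continuous.measurable

theorem le_add_sum_indicator_lt {c : ℝ} {J N : ℕ} (hc : c ≤ N) :
    c ≤ J + ∑ j ∈ Finset.Ico J N, if (j : ℝ) < c then (1 : ℝ) else 0 := by
  have h1 : ∑ j ∈ Finset.Ico J ⌈c⌉₊, (if (j : ℝ) < c then (1 : ℝ) else 0) = (⌈c⌉₊ - J : ℕ) := by
    rw [Finset.sum_congr rfl fun j hj => if_pos (Nat.lt_ceil.mp (Finset.mem_Ico.mp hj).2)]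
    simp
  have h2 := Finset.sum_le_sum_of_subset_of_nonneg
    (Finset.Ico_subset_Ico_right (Nat.ceil_le.mpr hc) : Finset.Ico J ⌈c⌉₊ ⊆ Finset.Ico J N)
    (f := fun j : ℕ => if (j : ℝ) < c then (1 : ℝ) else 0)
    fun j _ _ => by split_ifs <;> norm_num
  have h3 : (⌈c⌉₊ : ℝ) ≤ J + (⌈c⌉₊ - J : ℕ) := by
    exact_mod_cast (by omega : ⌈c⌉₊ ≤ J + (⌈c⌉₊ - J))
  have := Nat.le_ceil c
  linarith

theorem sum_indicator_le_le {c : ℝ} (hc : 0 ≤ c) (J : ℕ) :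
    ∑ j ∈ Finset.Icc 1 J, (if (j : ℝ) ≤ c then (1 : ℝ) else 0) ≤ c := by
  rw [← Finset.sum_filter, Finset.sum_const, nsmul_eq_mul, mul_one]
  refine le_trans ?_ (Nat.floor_le hc)
  have h : (Finset.Icc 1 J).filter (fun j : ℕ => (j : ℝ) ≤ c) ⊆ Finset.Icc 1 ⌊c⌋₊ := fun j hj => by
    obtain ⟨h1, h2⟩ := Finset.mem_filter.mp hj
    exact Finset.mem_Icc.mpr ⟨(Finset.mem_Icc.mp h1).1, Nat.le_floor h2⟩
  have := Finset.card_le_card h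
  rw [Nat.card_Icc, Nat.add_sub_cancel] at this
  exact_mod_cast this

theorem integral_coverageCost_le {m : ℕ} (hm : 0 < m) (A : Finset (Fin n)) (J : ℕ) :
    ∫ x, coverageCost x A ∂randomPlacement n ≤ 1 / (2 * m) * (J + ∑ j ∈ Finset.Ico J (2 * m),
      (randomPlacement n).real {x | (j : ℝ) / (2 * m) < coverageCost x A}) := by
  have hm0 : (0 : ℝ) < m := by exact_mod_cast hm
  have hint : ∀ j : ℕ, Integrable ({x : Fin n → ℝ | (j : ℝ) / (2 * m) < coverageCost x A}.indicator
      (1 : (Fin n → ℝ) → ℝ)) (randomPlacement n) := fun j =>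
    (integrable_const (1 : ℝ)).indicator (measurableSet_lt_coverageCost A _)
  have hint' := integrable_finsetSum (Finset.Ico J (2 * m)) fun j _ => hint j
  have h : ∀ᵐ x ∂randomPlacement n, coverageCost x A ≤ 1 / (2 * m) * (J +
      ∑ j ∈ Finset.Ico J (2 * m), {x : Fin n → ℝ | (j : ℝ) / (2 * m) < coverageCost x A}.indicator
        (1 : (Fin n → ℝ) → ℝ) x) := by
    filter_upwards [ae_mem_placements n] with x hx
    have h1 := le_add_sum_indicator_lt (c := 2 * m * coverageCost x A) (J := J) (N := 2 * m) (by
      push_cast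
      have := coverageCost_le_one (A := A) hx
      nlinarith)
    rw [one_div_mul_eq_div, le_div_iff₀ (by positivity), mul_comm]
    refine h1.trans_eq ?_
    congr 1
    refine Finset.sum_congr rfl fun j _ => ?_
    rw [indicator_apply]
    simp only [mem_ofPred_eq, div_lt_iff₀ (by positivity : (0 : ℝ) < 2 * m), Pi.one_apply,
      mul_comm (coverageCost x A)]
  refine (integral_mono_ae (integrable_coverageCost A)
    (((integrable_const (J : ℝ)).add hint').const_mul _) h).trans_eq ?_
  rw [integral_const_mul]
  congr 1
  refine (integral_add (integrable_const _) hint').trans ?_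
  rw [integral_finsetSum _ fun j _ => hint j, Finset.sum_congr rfl fun j _ =>
    integral_indicator_one (measurableSet_lt_coverageCost A _)]
  simp

theorem le_integral_coverageCost {m : ℕ} (hm : 0 < m) (A : Finset (Fin n)) (J : ℕ) :
    1 / (2 * m) * ∑ j ∈ Finset.Icc 1 J,
        (randomPlacement n).real {x | (j : ℝ) / m / 2 ≤ coverageCost x A}
      ≤ ∫ x, coverageCost x A ∂randomPlacement n := by
  have hm0 : (0 : ℝ) < m := by exact_mod_cast hm
  have hint : ∀ j : ℕ, Integrable ({x : Fin n → ℝ | (j : ℝ) / m / 2 ≤ coverageCost x A}.indicator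
      (1 : (Fin n → ℝ) → ℝ)) (randomPlacement n) := fun j =>
    (integrable_const (1 : ℝ)).indicator (measurableSet_le_coverageCost A _)
  have h : ∀ x, 1 / (2 * m) * ∑ j ∈ Finset.Icc 1 J,
      {x : Fin n → ℝ | (j : ℝ) / m / 2 ≤ coverageCost x A}.indicator
        (1 : (Fin n → ℝ) → ℝ) x ≤ coverageCost x A := by
    intro x
    rw [one_div_mul_eq_div, div_le_iff₀ (by positivity), mul_comm]
    refine le_trans (le_of_eq ?_) (sum_indicator_le_le
      (mul_nonneg (by positivity : (0 : ℝ) ≤ 2 * m) (coverageCost_nonneg x A)) J)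
    refine Finset.sum_congr rfl fun j _ => ?_
    rw [indicator_apply]
    simp only [mem_ofPred_eq, div_div, div_le_iff₀ (by positivity : (0 : ℝ) < m * 2), Pi.one_apply,
      mul_comm (coverageCost x A), mul_comm (2 : ℝ)]
  have h1 := integral_mono
    ((integrable_finsetSum (Finset.Icc 1 J) fun j _ => hint j).const_mul (1 / (2 * (m : ℝ))))
    (integrable_coverageCost A) h
  rw [integral_const_mul, integral_finsetSum _ fun j _ => hint j, Finset.sum_congr rfl fun j _ =>
    integral_indicator_one (measurableSet_le_coverageCost A _)] at h1
  exact h1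

/-- If the cost exceeds `j / (2m)`, then one of the windows of a grid of mesh `1 / m`, or one of
the two boundary windows, contains no active sensor. -/
theorem lt_coverageCost_subset (hA : A.Nonempty) {m j : ℕ} (hm : 0 < m) (hj : 1 ≤ j) :
    {x : Fin n → ℝ | (j : ℝ) / (2 * m) < coverageCost x A} ⊆
      (⋃ i ∈ Finset.range (m + 2 - j),
        {x | ∀ l ∈ A, x l ∉ Icc ((i : ℝ) / m) ((i + (j - 1)) / m)}) ∪
      ({x | ∀ l ∈ A, x l ∉ Icc (0 : ℝ) (j / (2 * m))} ∪
        {x | ∀ l ∈ A, x l ∉ Icc (1 - (j : ℝ) / (2 * m)) 1}) := by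
  intro x hx
  have hm0 : (0 : ℝ) < m := by exact_mod_cast hm
  obtain ⟨s, hs, h⟩ := exists_of_lt_coverageCost hA hx
  set t := (j : ℝ) / (2 * m) with ht
  have hjm : (j : ℝ) / m = 2 * t := by rw [ht]; field_simp
  rcases lt_or_ge s t with h1 | h1
  · refine Or.inr (Or.inl fun l hl hm => ?_)
    have := h l hl
    rw [lt_abs] at this
    rcases this with h2 | h2 <;> linarith [hm.1, hm.2, hs.1]
  rcases lt_or_ge (1 - t) s with h2 | h2
  · refine Or.inr (Or.inr fun l hl hm => ?_)
    have := h l hl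
    rw [lt_abs] at this
    rcases this with h2 | h2 <;> linarith [hm.1, hm.2, hs.2]
  left
  -- The interval `[s - t, s + t]` has length `j / m` and no active sensor. Rounding its left end up
  -- to the grid leaves room for a window of length `(j - 1) / m`.
  set i := ⌈(s - t) * m⌉₊ with hi
  have hi1 : (s - t) * m ≤ i := Nat.le_ceil _
  have hi2 : (i : ℝ) < (s - t) * m + 1 :=
    Nat.ceil_lt_add_one (mul_nonneg (by linarith) hm0.le)
  have hj2 : (j : ℝ) = 2 * t * m := by rw [← hjm]; field_simp
  have hr : i + j < m + 2 := by
    have : (i : ℝ) + j < m + 2 := by nlinarith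
    exact_mod_cast this
  simp only [mem_iUnion]
  refine ⟨i, Finset.mem_range.mpr (by omega), fun l hl hm => ?_⟩
  have h3 := h l hl
  have h4 := (div_le_iff₀ hm0).mp hm.1
  have h5 := (le_div_iff₀ hm0).mp hm.2
  have h6 : (s - t) * m ≤ x l * m := hi1.trans h4
  have h7 : x l * m ≤ (s + t) * m := by nlinarith
  have h8 := le_of_mul_le_mul_right h6 hm0
  have h9 := le_of_mul_le_mul_right h7 hm0
  rw [lt_abs] at h3
  rcases h3 with h3 | h3 <;> linarith

/-- Union bound: each inner window is empty with probability `(1 - (j - 1) / m) ^ m ≤ exp (1 - j)`,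
each boundary window with probability at most `exp (-j / 2)`. -/
theorem measureReal_lt_coverageCost_le {m j : ℕ} (hA : A.card = m) (hm : 0 < m) (hj : 1 ≤ j)
    (hj2 : j ≤ 2 * m) :
    (randomPlacement n).real {x | (j : ℝ) / (2 * m) < coverageCost x A}
      ≤ 2 * m * Real.exp (1 - j) + 2 * Real.exp (-(j / 2)) := by
  have hA' : A.Nonempty := Finset.card_pos.mp (hA ▸ hm)
  have hm0 : (0 : ℝ) < m := by exact_mod_cast hm
  have hj0 : (1 : ℝ) ≤ j := by exact_mod_cast hj
  have hj2' : (j : ℝ) ≤ 2 * m := by exact_mod_cast hj2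
  have ht0 : 0 ≤ (j : ℝ) / (2 * m) := by positivity
  have ht1 : (j : ℝ) / (2 * m) ≤ 1 := by rw [div_le_one (by positivity)]; exact hj2'
  have hedge : (1 - (j : ℝ) / (2 * m)) ^ m ≤ Real.exp (-(j / 2)) := by
    have := Real.one_sub_div_pow_le_exp_neg (n := m) (t := j / 2) (by linarith)
    rwa [div_div] at this
  have hwin : ∀ i ∈ Finset.range (m + 2 - j), (randomPlacement n).real
      {x | ∀ l ∈ A, x l ∉ Icc ((i : ℝ) / m) ((i + (j - 1)) / m)} ≤ Real.exp (1 - j) := by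
    intro i hi
    have hi' : i + j ≤ m + 1 := by have := Finset.mem_range.mp hi; omega
    have hi'' : (i : ℝ) + j ≤ m + 1 := by exact_mod_cast hi'
    have hi0 : (0 : ℝ) ≤ i := Nat.cast_nonneg i
    refine (measureReal_forall_notMem A measurableSet_Icc).trans_le ?_
    rw [hA, measureReal_Icc_of_subset (by positivity) (by gcongr; linarith)
      (by rw [div_le_one hm0]; linarith), ← sub_div, add_sub_cancel_left]
    have := Real.one_sub_div_pow_le_exp_neg (n := m) (t := j - 1) (by linarith)
    rwa [neg_sub] at this
  refine (measureReal_mono (lt_coverageCost_subset hA' hm hj)).trans ?_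
  refine (measureReal_union_le _ _).trans (add_le_add ?_ ?_)
  · refine (measureReal_biUnion_finset_le _ _).trans ((Finset.sum_le_sum hwin).trans ?_)
    rw [Finset.sum_const, Finset.card_range, nsmul_eq_mul]
    refine mul_le_mul_of_nonneg_right ?_ (Real.exp_pos _).le
    exact_mod_cast (by omega : m + 2 - j ≤ 2 * m)
  · refine (measureReal_union_le _ _).trans ?_
    rw [two_mul (Real.exp _)]
    refine add_le_add ?_ ?_
    · refine (measureReal_forall_notMem A measurableSet_Icc).trans_le ?_
      rwa [hA, measureReal_Icc_of_subset le_rfl (by positivity) ht1, sub_zero]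
    · refine (measureReal_forall_notMem A measurableSet_Icc).trans_le ?_
      rwa [hA, measureReal_Icc_of_subset (by linarith) (by linarith) le_rfl,
        sub_sub_cancel]

theorem sum_exp_neg_mul_le {a : ℝ} (ha : 0 < a) (J N : ℕ) :
    ∑ j ∈ Finset.Ico J N, Real.exp (-(a * j)) ≤ Real.exp (-(a * J)) / (1 - Real.exp (-a)) := by
  have h : ∀ j : ℕ, Real.exp (-(a * j)) = Real.exp (-a) ^ j := fun j => by
    rw [← Real.exp_nat_mul]
    congr 1
    ring
  simp only [h]
  exact geom_sum_Ico_le_of_lt_one (Real.exp_pos _).le (Real.exp_lt_one_iff.mpr (by linarith))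

theorem exists_integral_coverageCost_le : ∃ K : ℝ, ∀ n m : ℕ, 0 < m → ∀ A : Finset (Fin n),
    A.card = m → ∫ x, coverageCost x A ∂randomPlacement n ≤ Real.log m / (2 * m) + K / m := by
  refine ⟨1 / 2 + Real.exp 1 / (1 - Real.exp (-1)) + 1 / (1 - Real.exp (-(1 / 2))),
    fun n m hm A hA => ?_⟩
  have hm0 : (0 : ℝ) < m := by exact_mod_cast hm
  have hr1 : 0 < 1 - Real.exp (-1) := sub_pos.mpr (Real.exp_lt_one_iff.mpr (by norm_num))
  have hr2 : 0 < 1 - Real.exp (-(1 / 2)) := sub_pos.mpr (Real.exp_lt_one_iff.mpr (by norm_num))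
  -- As `J ≥ log m`, the geometric tail starting at `J` is `O(1 / m)`, which offsets the `O(m)`
  -- windows.
  set J := ⌊Real.log m⌋₊ + 1 with hJ
  have hJ1 : (J : ℝ) ≤ Real.log m + 1 := by
    rw [hJ]
    push_cast
    linarith [Nat.floor_le (Real.log_natCast_nonneg m)]
  have hJ2 : Real.log m ≤ J := by
    rw [hJ]
    push_cast
    exact (Nat.lt_floor_add_one _).le
  have h1 : ∑ j ∈ Finset.Ico J (2 * m),
      (randomPlacement n).real {x | (j : ℝ) / (2 * m) < coverageCost x A}
      ≤ 2 * (Real.exp 1 / (1 - Real.exp (-1))) + 2 * (1 / (1 - Real.exp (-(1 / 2)))) := by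
    calc _ ≤ ∑ j ∈ Finset.Ico J (2 * m),
          (2 * m * Real.exp (1 - j) + 2 * Real.exp (-(j / 2))) :=
          Finset.sum_le_sum fun j hj => by
            obtain ⟨h1, h2⟩ := Finset.mem_Ico.mp hj
            exact measureReal_lt_coverageCost_le hA hm (by omega) h2.le
      _ = 2 * m * Real.exp 1 * ∑ j ∈ Finset.Ico J (2 * m), Real.exp (-(1 * j))
          + 2 * ∑ j ∈ Finset.Ico J (2 * m), Real.exp (-(1 / 2 * j)) := by
          rw [Finset.sum_add_distrib, Finset.mul_sum, Finset.mul_sum]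
          congr 1
          · refine Finset.sum_congr rfl fun j _ => ?_
            rw [mul_assoc _ (Real.exp 1), ← Real.exp_add, one_mul, sub_eq_add_neg]
          · refine Finset.sum_congr rfl fun j _ => ?_
            rw [one_div_mul_eq_div]
      _ ≤ 2 * m * Real.exp 1 * (1 / m / (1 - Real.exp (-1)))
          + 2 * (1 / (1 - Real.exp (-(1 / 2)))) := by
          refine add_le_add (mul_le_mul_of_nonneg_left ?_ (by positivity))
            (mul_le_mul_of_nonneg_left ?_ (by norm_num))
          · refine (sum_exp_neg_mul_le one_pos _ _).trans
              (div_le_div_of_nonneg_right ?_ hr1.le)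
            rw [one_mul, one_div, ← Real.exp_log (inv_pos.mpr hm0), Real.log_inv]
            exact Real.exp_le_exp.mpr (by linarith)
          · refine (sum_exp_neg_mul_le (by norm_num) _ _).trans
              (div_le_div_of_nonneg_right ?_ hr2.le)
            exact Real.exp_le_one_iff.mpr (by
              have : (0 : ℝ) ≤ J := Nat.cast_nonneg J
              linarith)
      _ = _ := by
          field_simp
  refine (integral_coverageCost_le hm A J).trans ?_
  refine (mul_le_mul_of_nonneg_left (add_le_add hJ1 h1) (by positivity)).trans_eq ?_
  field_simp
  ring

theorem sum_exp_Icc_le (J : ℕ) : ∑ j ∈ Finset.Icc 1 J, Real.exp j ≤ 2 * Real.exp J := by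
  induction J with
  | zero => simp
  | succ J ih =>
    rw [Finset.sum_Icc_succ_top (by omega)]
    have h1 : Real.exp ((J + 1 : ℕ) : ℝ) = Real.exp J * Real.exp 1 := by
      rw [← Real.exp_add]
      push_cast
      rfl
    have h2 : (2 : ℝ) ≤ Real.exp 1 := by linarith [Real.add_one_le_exp (1 : ℝ)]
    rw [h1]
    nlinarith [Real.exp_pos (J : ℝ)]

/-- The second moment bound at `d = j / m`. From `j ^ 2 / 2 ≤ exp j ≤ m` follow `d ≤ 1 / 2` and `m *
d / (1 - d) ≤ j + 2 * j * d ≤ j + 4`, whence `exp 4`. The `30` comes from `(1 + y) ^ 4 ≤ 1 + 15 * y`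
at `y = 2 * d ≤ 1`. -/
theorem measureReal_le_coverageCost_ge {m j J : ℕ} (hA : A.card = m) (hj1 : 1 ≤ j) (hjJ : j ≤ J)
    (hJ : Real.exp J ≤ m) :
    1 - Real.exp 4 * Real.exp j / m - 30 * J / m
      ≤ (randomPlacement n).real {x | (j : ℝ) / m / 2 ≤ coverageCost x A} := by
  have hj0 : (1 : ℝ) ≤ j := by exact_mod_cast hj1
  have hjJ' : (j : ℝ) ≤ J := by exact_mod_cast hjJ
  have hexp : Real.exp j ≤ m := (Real.exp_le_exp.mpr hjJ').trans hJ
  have hq := Real.quadratic_le_exp_of_nonneg (by linarith : (0 : ℝ) ≤ j)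
  have h2j : 2 * (j : ℝ) ≤ m := by nlinarith [sq_nonneg ((j : ℝ) - 1)]
  have hjsq : (j : ℝ) ^ 2 ≤ 2 * m := by nlinarith
  have hm0 : (0 : ℝ) < m := by linarith
  have hm2 : 2 ≤ m := by
    have : (2 : ℝ) ≤ m := by linarith
    exact_mod_cast this
  set d := (j : ℝ) / m with hd
  have hd0 : 0 < d := by positivity
  have hd1 : 2 * d ≤ 1 := by
    rw [hd, mul_div_assoc', div_le_one hm0]
    exact h2j
  have h1d : 0 < 1 - d := by linarith
  have hmain := le_measureReal_coverageCost hd0.le hd1 (hA ▸ hm2 : 2 ≤ A.card)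
  rw [hA] at hmain
  have hjd : j * d ≤ 2 := by
    rw [hd, mul_div_assoc', div_le_iff₀ hm0, ← sq]
    exact hjsq
  have hdm : m * d = j := by rw [hd]; field_simp
  have hinv : 1 / (1 - d) ≤ 1 + 2 * d := by
    rw [div_le_iff₀ h1d]
    nlinarith
  have h1 : 1 / (1 - d) ^ m ≤ Real.exp (j + 4) := by
    have h3 : 1 / (1 - d) ≤ Real.exp (d / (1 - d)) := by
      have := Real.add_one_le_exp (d / (1 - d))
      have h4 : d / (1 - d) + 1 = 1 / (1 - d) := by
        field_simp
        ring
      linarith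
    rw [← one_div_pow]
    refine (pow_le_pow_left₀ (by positivity) h3 m).trans ?_
    rw [← Real.exp_nat_mul]
    refine Real.exp_le_exp.mpr ?_
    have h5 : d / (1 - d) ≤ d * (1 + 2 * d) := by
      rw [div_eq_mul_one_div]
      exact mul_le_mul_of_nonneg_left hinv hd0.le
    calc m * (d / (1 - d)) ≤ m * (d * (1 + 2 * d)) := mul_le_mul_of_nonneg_left h5 hm0.le
      _ = m * d + 2 * (m * d * d) := by ring
      _ ≤ j + 4 := by rw [hdm]; linarith
  have h2 : 1 / (m * (1 - d) ^ m) ≤ Real.exp 4 * Real.exp j / m := by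
    rw [← Real.exp_add, mul_comm (m : ℝ), ← div_div, add_comm 4]
    exact div_le_div_of_nonneg_right h1 hm0.le
  have h3 : 1 / (1 - d) ^ 4 - 1 ≤ 30 * J / m := by
    rw [← one_div_pow]
    have h4 : (1 / (1 - d)) ^ 4 ≤ (1 + 2 * d) ^ 4 := pow_le_pow_left₀ (by positivity) hinv 4
    have h5 : (1 + 2 * d) ^ 4 ≤ 1 + 30 * d := by
      have h6 : (2 * d) ^ 2 ≤ 2 * d := by nlinarith
      have h7 : (2 * d) ^ 3 ≤ 2 * d := by nlinarith
      have h8 : (2 * d) ^ 4 ≤ 2 * d := by nlinarith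
      nlinarith
    have h9 : 30 * d ≤ 30 * J / m := by
      rw [hd, mul_div_assoc']
      gcongr
    linarith
  linarith

theorem exists_le_integral_coverageCost : ∃ K : ℝ, ∀ n m : ℕ, 0 < m → ∀ A : Finset (Fin n),
    A.card = m → Real.log m / (2 * m) - K / m ≤ ∫ x, coverageCost x A ∂randomPlacement n := by
  refine ⟨1 / 2 + Real.exp 4 + 30, fun n m hm A hA => ?_⟩
  have hm0 : (0 : ℝ) < m := by exact_mod_cast hm
  -- Since `exp J ≤ m`, the errors summed over `j ≤ J` stay bounded: at most `2 * exp 4` from the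
  -- exponentials and `30 * J ^ 2 / m ≤ 60`.
  set J := ⌊Real.log m⌋₊ with hJ
  have hJ1 : (J : ℝ) ≤ Real.log m := Nat.floor_le (Real.log_natCast_nonneg m)
  have hJ2 : Real.log m < J + 1 := Nat.lt_floor_add_one _
  have hexp : Real.exp J ≤ m := by
    rw [← Real.exp_log hm0]
    exact Real.exp_le_exp.mpr hJ1
  refine le_trans ?_ (le_integral_coverageCost hm A J)
  have h1 : ∑ j ∈ Finset.Icc 1 J, (1 - Real.exp 4 * Real.exp j / m - 30 * J / m)
      ≤ ∑ j ∈ Finset.Icc 1 J,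
        (randomPlacement n).real {x | (j : ℝ) / m / 2 ≤ coverageCost x A} :=
    Finset.sum_le_sum fun j hj => measureReal_le_coverageCost_ge hA (Finset.mem_Icc.mp hj).1
      (Finset.mem_Icc.mp hj).2 hexp
  have h2 : ∑ j ∈ Finset.Icc 1 J, (1 - Real.exp 4 * Real.exp j / m - 30 * J / m)
      = J - Real.exp 4 * (∑ j ∈ Finset.Icc 1 J, Real.exp j) / m - 30 * (J ^ 2 / m) := by
    rw [Finset.sum_sub_distrib, Finset.sum_sub_distrib, ← Finset.sum_div, ← Finset.mul_sum]
    simp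
    ring
  have h3 : Real.exp 4 * (∑ j ∈ Finset.Icc 1 J, Real.exp j) / m ≤ 2 * Real.exp 4 := by
    rw [div_le_iff₀ hm0]
    nlinarith [sum_exp_Icc_le J, Real.exp_pos 4]
  have h4 : (J : ℝ) ^ 2 / m ≤ 2 := by
    rw [div_le_iff₀ hm0]
    have := Real.quadratic_le_exp_of_nonneg (Nat.cast_nonneg J : (0 : ℝ) ≤ J)
    have := (Nat.cast_nonneg J : (0 : ℝ) ≤ J)
    linarith
  have h5 : Real.log m / (2 * m) - (1 / 2 + Real.exp 4 + 30) / m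
      = 1 / (2 * m) * (Real.log m - 1 - 2 * Real.exp 4 - 60) := by
    field_simp
    ring
  rw [h5]
  exact mul_le_mul_of_nonneg_left (by linarith) (by positivity)

/-- Only sets of size `m` have positive probability, and the bounds for a fixed `A` depend on `A`
through `m` alone, so they survive averaging. -/
theorem exists_random_bounds : ∃ K : ℝ, ∀ n k m : ℕ, 0 < k → k < n → m + k = n →
    Integrable (constFailCost n k) (randomPlacement n) ∧
    |(∫ x, constFailCost n k x ∂(randomPlacement n)) - Real.log m / (2 * m)| ≤ K / m := by
  obtain ⟨K₁, h₁⟩ := exists_integral_coverageCost_le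
  obtain ⟨K₂, h₂⟩ := exists_le_integral_coverageCost
  refine ⟨max K₁ K₂, fun n k m _ hk hmk => ?_⟩
  have hm : 0 < m := by omega
  have hint : ∀ A : Finset (Fin n),
      Integrable (fun x => constFailProb n k A * coverageCost x A) (randomPlacement n) :=
    fun A => (integrable_coverageCost A).const_mul _
  have hC : constFailCost n k = fun x => ∑ A, constFailProb n k A * coverageCost x A := rfl
  refine ⟨hC ▸ integrable_finsetSum _ fun A _ => hint A, ?_⟩
  have h : ∀ A : Finset (Fin n), |constFailProb n k A * (∫ x, coverageCost x A ∂randomPlacement n)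
      - constFailProb n k A * (Real.log m / (2 * m))| ≤ constFailProb n k A * (max K₁ K₂ / m) := by
    intro A
    rw [← mul_sub, abs_mul, abs_of_nonneg (constFailProb_nonneg n k A)]
    by_cases hA : A.card = m
    · refine mul_le_mul_of_nonneg_left (abs_le.mpr ?_) (constFailProb_nonneg n k A)
      have e1 : K₁ / m ≤ max K₁ K₂ / m := by gcongr; exact le_max_left _ _
      have e2 : K₂ / m ≤ max K₁ K₂ / m := by gcongr; exact le_max_right _ _
      constructor <;> linarith [h₁ n m hm A hA, h₂ n m hm A hA]
    · have : constFailProb n k A = 0 := by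
        have hc := A.card_le_univ
        rw [Fintype.card_fin] at hc
        rw [constFailProb, if_neg]
        rw [Finset.card_compl, Fintype.card_fin]
        omega
      rw [this, zero_mul, zero_mul]
  have e : (∫ x, constFailCost n k x ∂randomPlacement n) - Real.log m / (2 * m)
      = ∑ A : Finset (Fin n), (constFailProb n k A * (∫ x, coverageCost x A ∂randomPlacement n)
        - constFailProb n k A * (Real.log m / (2 * m))) := by
    rw [Finset.sum_sub_distrib, ← Finset.sum_mul, sum_constFailProb hk.le, one_mul]
    congr 1
    rw [hC, integral_finsetSum _ fun A _ => hint A]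
    exact Finset.sum_congr rfl fun A _ => integral_const_mul _ _
  rw [e]
  refine (Finset.abs_sum_le_sum_abs _ _).trans ((Finset.sum_le_sum fun A _ => h A).trans_eq ?_)
  rw [← Finset.sum_mul, sum_constFailProb hk.le, one_mul]

end

end SensorPlacement

open SensorPlacement in
theorem mainTheorem5 :
    -- (a) equivalence with the linear program
    (∀ n k : ℕ, 0 < k → k < n → ∀ x : Fin n → ℝ, Monotone x →
      (IsOptimalPlacement (constFailProb n k) x ↔ ∃ w, IsLPOptimal (constFailProb n k) x w)) ∧
    -- (b) asymptotic cost of the equispaced placement, for a fixed ratio `k / n = q`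
    (∀ q : ℝ, 0 < q → q < 1 →
      (∀ n k : ℕ → ℕ, Tendsto n atTop atTop → (∀ j, (k j : ℝ) / n j = q) →
        (fun j => constFailCost (n j) (k j) (equispaced (n j))) ~[atTop]
          fun j => 1 / (2 * Real.log ((n j : ℝ) / k j)) * (Real.log (n j) / n j)) ∧
      (∀ ε : ℝ, 0 < ε → ε < min q (1 - q) →
        ∃ K : ℝ, ∀ n k : ℕ, 0 < k → k < n → (k : ℝ) / n = q →
          1 / (2 * Real.log (n / (k - n * ε))) * (Real.log n / n) - K / n
            ≤ constFailCost n k (equispaced n) ∧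
          constFailCost n k (equispaced n)
            ≤ 1 / (2 * Real.log (n / (k + n * ε))) * (Real.log n / n) + K / n)) ∧
    -- (c) near-optimality of the equispaced placement
    (∀ n k : ℕ, 0 < k → k < n →
      (∃ xopt : Fin n → ℝ, IsOptimalPlacement (constFailProb n k) xopt) ∧
      ∀ xopt : Fin n → ℝ, IsOptimalPlacement (constFailProb n k) xopt →
        constFailCost n k (equispaced n)
          ≤ constFailCost n k xopt + 2 / (n : ℝ) * ((k : ℝ) / ((n : ℝ) - k))) ∧
    -- (d) asymptotic cost of the random placement, `m` being the number of active sensors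
    (∃ K : ℝ, ∀ n k m : ℕ, 0 < k → k < n → m + k = n →
      Integrable (constFailCost n k) (randomPlacement n) ∧
      |(∫ x, constFailCost n k x ∂(randomPlacement n)) - Real.log m / (2 * m)| ≤ K / m) := by
  refine ⟨fun n k _ hkn x hx => isOptimalPlacement_iff_isLPOptimal hkn hx,
    fun q hq0 hq1 => ⟨fun n k hn hk => equispaced_isEquivalent hq0 hq1 hn hk,
      fun ε hε hεq => equispaced_bounds hε hεq⟩,
    fun n k _ hkn => ⟨exists_isOptimalPlacement _, fun xopt hopt => ?_⟩, exists_random_bounds⟩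
  have : NeZero n := ⟨by omega⟩
  exact equispaced_near_optimal hkn hopt.1
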